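/- Let $d,N\ge 1$ be integers and let $\delta\ge 2$. For a probability measure $\rho$ on $\mathbb R^d$ with marginals $\rho_1,\dots,\rho_d$ (and finite second moments) write $$m(\rho)=\int x\,d\rho(x)\in\mathbb R^d,\qquad m_2(\rho)=\Big(\int x^2\,d\rho_j(x)\Big)_{j\le d},\qquad \operatorname{Var}(\rho)=(\operatorname{Var}(\rho_j))_{j\le d},$$ and consider the observables $F_{\rm mean}=m$, $F_{\rm s.m}=m_2$, $F_{\rm var}=\operatorname{Var}$ (with values in $\mathbb R^d$) and $[F_{\rm mean},F_{\rm var}]$ (with values in $\mathbb R^{2d}$). For $y=(y^1,\dots,y^N)\in(\mathbb R^d)^N$ let $\hat\rho_y=\frac1N\sum_{i=1}^N\delta_{y^i}$. Let $a_+^\delta(z)=\big(\frac{\delta-1}{2z_j}\big)_{j\le d}$ and $s_+^\delta(z)=I_d$, the coefficients of $d$ independent $\delta$-Bessel processes. Products and quotients of vectors are componentwise. On a filtered probability space let $B$ be a standard Brownian motion in $\mathbb R^p$, with $p=d$ in cases 1–3 and $p=2d$ in case 4, and let $Y=(Y^1,\dots,Y^N)$ be continuous adapted $\mathbb R^d$-valued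 processes on $[0,\infty)$ solving the particle system with common noise $$dY^i_t=\tilde b(Y^i_t,\hat\rho_{Y_t})\,dt+\tilde\sigma(Y^i_t,\hat\rho_{Y_t})\,dB_t,\qquad i=1,\dots,N .$$ In case 2 assume that almost surely every component of $m_2(\hat\rho_{Y_t})$ is positive for all $t\ge0$, and in cases 3 and 4 that almost surely every component of $\operatorname{Var}(\hat\rho_{Y_t})$ is positive for all $t\ge0$, so that the coefficients are defined along the solution. Then, with the coefficients below, which do not depend on $N$, the observable $F(\hat\rho_{Y_t})$ solves, with the same Brownian motion $B$, $$dF(\hat\rho_{Y_t})=a(F(\hat\rho_{Y_t}))\,dt+s(F(\hat\rho_{Y_t}))\,dB_t .$$ 1. Mean: $F=F_{\rm mean}$, $(a,s)=(0,I_d)$, with $\tilde b(x,\rho)=0$ and $\tilde\sigma(x,\rho)=I_d$. 2. Second moment: $F=F_{\rm s.m}$, $(a,s)=(a_+^\delta,s_+^\delta)$, with $$\tilde b(x,\rho)=\Big(\delta-\frac32\Big)\frac{x}{4\,m_2(\rho)^2},\qquad \tilde\sigma(x,\rho)=\operatorname{Diag}\Big[\frac{x}{2\,m_2(\rho)}\Big].$$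 3. Variance: $F=F_{\rm var}$, $(a,s)=(a_+^\delta,s_+^\delta)$, with $$\tilde b(x,\rho)=\Big(\delta-\frac32\Big)\frac{x-m(\rho)}{4\operatorname{Var}(\rho)^2},\qquad \tilde\sigma(x,\rho)=\operatorname{Diag}\Big[\frac{x-m(\rho)}{2\operatorname{Var}(\rho)}\Big].$$ 4. Mean and variance: $F=[F_{\rm mean},F_{\rm var}]$, $a(z^1,z^2)=(0,a_+^\delta(z^2))$, $s(z^1,z^2)=\begin{pmatrix}I_d&0\\0&s_+^\delta(z^2)\end{pmatrix}=I_{2d}$, with $\tilde b$ as in case 3 and the $d\times 2d$ matrix $$\tilde\sigma(x,\rho)=\Big(I_d\,,\ \operatorname{Diag}\Big[\frac{x-m(\rho)}{2\operatorname{Var}(\rho)}\Big]\Big).$$ -/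

import Mathlib

open MeasureTheory ProbabilityTheory Filter Topology
open scoped NNReal ENNReal

noncomputable section

namespace SMD

/-- Euclidean space `ℝ^κ` for a finite index type `κ`; `ℝ^d` is `Vec (Fin d)` and `ℝ^{2d}` is
`Vec (Fin d ⊕ Fin d)`. -/
abbrev Vec (κ : Type) [Fintype κ] := EuclideanSpace ℝ κ

/-! ### Brownian motion, the Itô integral and Itô processes -/

section Stochastic

variable {Ω : Type*} [mΩ : MeasurableSpace Ω]

/-- Standard Brownian motion in `ℝ^κ`, started at the origin, relative to the filtration `𝓕`. -/
structure IsBrownianMotion {κ : Type} [Fintype κ] [DecidableEq κ] (P : Measure Ω)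
    (𝓕 : Filtration ℝ≥0 mΩ) (B : ℝ≥0 → Ω → Vec κ) : Prop where
  adapted : Adapted 𝓕 B
  zero : ∀ᵐ ω ∂P, B 0 ω = 0
  cont : ∀ᵐ ω ∂P, Continuous fun t => B t ω
  indep : ∀ s t : ℝ≥0, s ≤ t →
    Indep (MeasurableSpace.comap (fun ω => B t ω - B s ω) inferInstance) (𝓕 s) P
  law : ∀ s t : ℝ≥0, s ≤ t →
    HasLaw (fun ω => B t ω - B s ω)
      (multivariateGaussian (0 : Vec κ) (((t : ℝ) - (s : ℝ)) • (1 : Matrix κ κ ℝ))) P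

/-- A simple integrand `∑_{k < n} ξ_k 1_{(t_k, t_{k+1}]}` with nondecreasing deterministic times
and `ξ_k` bounded and `𝓕_{t_k}`-measurable. -/
structure SimpleProcess (𝓕 : Filtration ℝ≥0 mΩ) where
  n : ℕ
  time : ℕ → ℝ≥0
  mono : Monotone time
  ξ : ℕ → Ω → ℝ
  meas : ∀ k, Measurable[𝓕 (time k)] (ξ k)
  bdd : ∀ k, ∃ C : ℝ, ∀ ω, |ξ k ω| ≤ C

namespace SimpleProcess

variable {𝓕 : Filtration ℝ≥0 mΩ}

/-- The value of the simple process at time `t`. -/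
def eval (S : SimpleProcess 𝓕) (t : ℝ≥0) (ω : Ω) : ℝ :=
  ∑ k ∈ Finset.range S.n,
    (Set.Ioc (S.time k) (S.time (k + 1))).indicator (fun _ => S.ξ k ω) t

/-- The elementary stochastic integral `∫₀ᵗ S dW`. -/
def integral (S : SimpleProcess 𝓕) (W : ℝ≥0 → Ω → ℝ) (t : ℝ≥0) (ω : Ω) : ℝ :=
  ∑ k ∈ Finset.range S.n,
    S.ξ k ω * (W (min t (S.time (k + 1))) ω - W (min t (S.time k)) ω)

end SimpleProcess

/-- `M_t = ∫₀ᵗ H dW` for all `t` (Itô integral of a real integrand against a real Brownian motion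
`W` relative to `𝓕`): some sequence of simple processes `S m` satisfies, for every `t`,
`∫₀ᵗ |S m - H|² ds → 0` in probability and `∫₀ᵗ S m dW → M_t` in probability. -/
def IsItoIntegral (P : Measure Ω) (𝓕 : Filtration ℝ≥0 mΩ) (W H M : ℝ≥0 → Ω → ℝ) : Prop :=
  ∃ S : ℕ → SimpleProcess 𝓕, ∀ t : ℝ≥0,
    (∀ ε : ℝ≥0∞, 0 < ε → Tendsto
      (fun m => P {ω | ε ≤ ∫⁻ s in Set.Icc (0 : ℝ) t,
        ENNReal.ofReal (((S m).eval s.toNNReal ω - H s.toNNReal ω) ^ 2)}) atTop (𝓝 0)) ∧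
    TendstoInMeasure P (fun m => (S m).integral W t) atTop (M t)

/-- `dX_t = u_t dt + v_t dB_t` on `[0, ∞)`: the process `X` in `ℝ^κ` is adapted and continuous, the
drift `u` is locally integrable in time, and coordinatewise
`X^j_t = X^j_0 + ∫₀ᵗ u^j_s ds + ∑_k ∫₀ᵗ v^{jk}_s dB^k_s` (Itô integrals). -/
structure IsItoProcess {κ ι : Type} [Fintype κ] [Fintype ι] (P : Measure Ω)
    (𝓕 : Filtration ℝ≥0 mΩ) (B : ℝ≥0 → Ω → Vec ι) (X : ℝ≥0 → Ω → Vec κ)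
    (u : ℝ≥0 → Ω → Vec κ) (v : ℝ≥0 → Ω → Matrix κ ι ℝ) : Prop where
  adapted : Adapted 𝓕 X
  cont : ∀ᵐ ω ∂P, Continuous fun t => X t ω
  drift_integrable : ∀ᵐ ω ∂P, ∀ t : ℝ≥0,
    IntegrableOn (fun s : ℝ => u s.toNNReal ω) (Set.Icc (0 : ℝ) t)
  eq : ∃ M : κ → ι → ℝ≥0 → Ω → ℝ,
    (∀ j k, IsItoIntegral P 𝓕 (fun t ω => B t ω k) (fun t ω => v t ω j k) (M j k)) ∧
    ∀ t : ℝ≥0, ∀ᵐ ω ∂P, ∀ j,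
      X t ω j = X 0 ω j + (∫ s in Set.Icc (0 : ℝ) t, u s.toNNReal ω j) + ∑ k, M j k t ω

/-- `dZ_t = a(Z_t) dt + s(Z_t) dB_t`. -/
def SolvesSDE {κ ι : Type} [Fintype κ] [Fintype ι] (P : Measure Ω)
    (𝓕 : Filtration ℝ≥0 mΩ) (B : ℝ≥0 → Ω → Vec ι)
    (a : Vec κ → Vec κ) (s : Vec κ → Matrix κ ι ℝ) (Z : ℝ≥0 → Ω → Vec κ) : Prop :=
  IsItoProcess P 𝓕 B Z (fun t ω => a (Z t ω)) (fun t ω => s (Z t ω))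

end Stochastic

/-! ### Empirical measures and particle systems driven by a common noise -/

/-- The empirical measure `(1/N) ∑ᵢ δ_{xᵢ}` of `N ≥ 1` points. -/
def empirical {N d : ℕ} [NeZero N] (x : Fin N → Vec (Fin d)) :
    ProbabilityMeasure (Vec (Fin d)) :=
  ⟨(N : ℝ≥0∞)⁻¹ • ∑ i, Measure.dirac (x i), ⟨by
    simp [ENNReal.inv_mul_cancel, NeZero.ne N]⟩⟩

/-- `dYⁱ_t = b(Yⁱ_t, ρ_t) dt + σ(Yⁱ_t, ρ_t) dB_t` for every `i`, where `ρ_t` is the empirical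
measure of `Y¹_t, …, Y^N_t` and the Brownian motion `B` is common to all the particles. -/
def SolvesParticleSystem {Ω : Type*} [mΩ : MeasurableSpace Ω] {N d : ℕ} [NeZero N]
    {ι : Type} [Fintype ι] (P : Measure Ω) (𝓕 : Filtration ℝ≥0 mΩ) (B : ℝ≥0 → Ω → Vec ι)
    (b : Vec (Fin d) → ProbabilityMeasure (Vec (Fin d)) → Vec (Fin d))
    (σ : Vec (Fin d) → ProbabilityMeasure (Vec (Fin d)) → Matrix (Fin d) ι ℝ)
    (Y : Fin N → ℝ≥0 → Ω → Vec (Fin d)) : Prop :=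
  ∀ i, IsItoProcess P 𝓕 B (Y i)
    (fun t ω => b (Y i t ω) (empirical fun l => Y l t ω))
    (fun t ω => σ (Y i t ω) (empirical fun l => Y l t ω))

/-! ### Observables -/

variable {d : ℕ}

/-- The `j`-th marginal of `ρ`. -/
def marginal (ρ : ProbabilityMeasure (Vec (Fin d))) (j : Fin d) : Measure ℝ :=
  (ρ : Measure (Vec (Fin d))).map fun x => x j

/-- The mean `m(ρ)`. -/
def obsMean (ρ : ProbabilityMeasure (Vec (Fin d))) : Vec (Fin d) :=
  ∫ x, x ∂(ρ : Measure (Vec (Fin d)))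

/-- The vector `m₂(ρ)` of the second moments of the marginals. -/
def obsSecondMoment (ρ : ProbabilityMeasure (Vec (Fin d))) : Vec (Fin d) :=
  WithLp.toLp 2 fun j => ∫ x, x ^ 2 ∂(marginal ρ j)

/-- The vector `Var(ρ)` of the variances of the marginals. -/
def obsVar (ρ : ProbabilityMeasure (Vec (Fin d))) : Vec (Fin d) :=
  WithLp.toLp 2 fun j => Var[id; marginal ρ j]

/-- The pair `[m(ρ), Var(ρ)]` as a vector of `ℝ^{2d}`. -/
def obsMeanVar (ρ : ProbabilityMeasure (Vec (Fin d))) : Vec (Fin d ⊕ Fin d) :=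
  WithLp.toLp 2 (Sum.elim (obsMean ρ) (obsVar ρ))

/-! ### Prescribed coefficients `a`, `s` of the observables -/

/-- Componentwise drift `(δ - 1) / (2 z_j)` of the `δ`-Bessel process. -/
def besselDrift (δ : ℝ) (z : Vec (Fin d)) : Vec (Fin d) :=
  WithLp.toLp 2 fun j => (δ - 1) / (2 * z j)

/-- Diffusion matrix of `d` independent Bessel processes. -/
def besselDiffusion (_z : Vec (Fin d)) : Matrix (Fin d) (Fin d) ℝ := 1

/-- `(z¹, z²) ↦ (0, besselDrift δ z²)` on `ℝ^{2d}`. -/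
def meanVarTargetDrift (δ : ℝ) (z : Vec (Fin d ⊕ Fin d)) : Vec (Fin d ⊕ Fin d) :=
  WithLp.toLp 2
    (Sum.elim (fun _ => 0) (besselDrift δ (WithLp.toLp 2 fun j => z (Sum.inr j))))

/-- Block diagonal matrix with blocks the identity and the Bessel diffusion matrix. -/
def meanVarTargetDiffusion (z : Vec (Fin d ⊕ Fin d)) :
    Matrix (Fin d ⊕ Fin d) (Fin d ⊕ Fin d) ℝ :=
  Matrix.fromBlocks 1 0 0 (besselDiffusion (WithLp.toLp 2 fun j => z (Sum.inr j)))

/-! ### The coefficients `b̃`, `σ̃` -/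

def driftMean (_x : Vec (Fin d)) (_ρ : ProbabilityMeasure (Vec (Fin d))) : Vec (Fin d) := 0

def diffusionMean (_x : Vec (Fin d)) (_ρ : ProbabilityMeasure (Vec (Fin d))) :
    Matrix (Fin d) (Fin d) ℝ := 1

def driftSecondMoment (δ : ℝ) (x : Vec (Fin d)) (ρ : ProbabilityMeasure (Vec (Fin d))) :
    Vec (Fin d) :=
  WithLp.toLp 2 fun j => (δ - 3 / 2) * (x j / (4 * obsSecondMoment ρ j ^ 2))

def diffusionSecondMoment (x : Vec (Fin d)) (ρ : ProbabilityMeasure (Vec (Fin d))) :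
    Matrix (Fin d) (Fin d) ℝ :=
  Matrix.diagonal fun j => x j / (2 * obsSecondMoment ρ j)

/-- Also the drift for the observable mean + variance. -/
def driftVar (δ : ℝ) (x : Vec (Fin d)) (ρ : ProbabilityMeasure (Vec (Fin d))) : Vec (Fin d) :=
  WithLp.toLp 2 fun j => (δ - 3 / 2) * ((x j - obsMean ρ j) / (4 * obsVar ρ j ^ 2))

def diffusionVar (x : Vec (Fin d)) (ρ : ProbabilityMeasure (Vec (Fin d))) :
    Matrix (Fin d) (Fin d) ℝ :=
  Matrix.diagonal fun j => (x j - obsMean ρ j) / (2 * obsVar ρ j)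

def diffusionMeanVar (x : Vec (Fin d)) (ρ : ProbabilityMeasure (Vec (Fin d))) :
    Matrix (Fin d) (Fin d ⊕ Fin d) ℝ :=
  Matrix.fromCols 1 (diffusionVar x ρ)

end SMD

end

/-! Work coordinate by coordinate, and let `W` be the scalar noise that multiplies the positions.
The core is `bessel_of_mean_sq`: let dX_i = u_i dt + v_i dW with u_i = (δ - 3/2) X_i / (4V²), v_i =
X_i / (2V) and V the mean of the X_i². Itô's formula gives d(X_i²) = (2 X_i u_i + v_i²) dt + 2 X_i
v_i dW. The drift is X_i² (δ - 1) / (2V²), because (δ - 3/2)/2 + 1/4 = (δ - 1)/2, and the noise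
coefficient is X_i² / V. Averaging over i turns X_i² into V and leaves dV = (δ - 1)/(2V) dt + dW.

For the second moment X_i is the position itself. For the variance X_i is the deviation from the
mean: deviations sum to zero, so the mean feels neither the drift nor `W`, and any other noise moves
all particles alike and cancels in the deviations (`bessel_of_variance`). The mean needs only
linearity and uniqueness of the Itô integral (`average_eq`).

Itô's formula for squares is derived from the definition of the integral in Riemann-sum form
(`exists_seq_tendsto_sq_sub_sum`). The limit of the sums of 2 X v ΔW is never identified as an Itô
integral: after averaging the integrand is exactly 1, so the sums telescope to W_t - W_0 on every
partition.

A pathwise expansion (`tendsto_sq_sub_sum`) reduces that formula to three errors: the residuals of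
freezing the integrand at partition points, summed against X; the sum of the squared residuals; and
∑ v² ((ΔW)² - Δt). Each is controlled by discrete stochastic integrals whose energy tends to zero
almost surely. Lenglart's inequality (`IsIndepIncrements.tendstoInMeasure_zero`) then gives
convergence in probability without any moment bound on the solution. -/

noncomputable section

namespace SMD

/-! ### Truncation of discrete integrands -/

/-- The integrand `ξ` stopped before `∑ q ξ²` exceeds `δ`. -/
def truncated {Ω : Type*} (q : ℕ → ℝ) (δ : ℝ) (ξ : ℕ → Ω → ℝ) (l : ℕ) (ω : Ω) : ℝ :=
  if q l ≠ 0 ∧ ∑ j ∈ Finset.range (l + 1), q j * ξ j ω ^ 2 ≤ δ then ξ l ω else 0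

section truncated

variable {Ω : Type*} {q : ℕ → ℝ} {δ : ℝ} {ξ : ℕ → Ω → ℝ}

/-- The single term `q l * ξ l ω ^ 2` is already at most `δ` wherever the integrand is kept.
Discarding indices with `q l = 0` is what makes the bound uniform in `ω`. -/
lemma truncated_bdd (hq : ∀ l, 0 ≤ q l) (l : ℕ) :
    ∃ C : ℝ, ∀ ω, |truncated q δ ξ l ω| ≤ C := by
  refine ⟨√(δ / q l), fun ω => ?_⟩
  unfold truncated
  split_ifs with h
  · refine Real.abs_le_sqrt ?_
    have hpos : 0 < q l := lt_of_le_of_ne (hq l) h.1.symm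
    rw [le_div_iff₀ hpos, mul_comm]
    refine le_trans ?_ h.2
    exact Finset.single_le_sum (f := fun j => q j * ξ j ω ^ 2)
      (fun j _ => mul_nonneg (hq j) (sq_nonneg _)) (Finset.self_mem_range_succ l)
  · simp

/-- The test at index `l` involves only `ξ 0, …, ξ l`, so truncation preserves predictability. -/
lemma truncated_measurable {G : ℕ → MeasurableSpace Ω} (hG : Monotone G)
    (hξ : ∀ l, Measurable[G l] (ξ l)) (l : ℕ) : Measurable[G l] (truncated q δ ξ l) := by
  unfold truncated
  have hm : MeasurableSet[G l] {ω | ∑ j ∈ Finset.range (l + 1), q j * ξ j ω ^ 2 ≤ δ} := by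
    refine measurableSet_le ?_ measurable_const
    refine Finset.measurable_fun_sum _ fun j hj => ?_
    have : j ≤ l := Nat.lt_succ_iff.1 (Finset.mem_range.1 hj)
    exact (((hξ j).mono (hG this) le_rfl).pow_const 2).const_mul _
  exact Measurable.ite ((MeasurableSet.const (q l ≠ 0)).inter hm) (hξ l) measurable_const

lemma sum_truncated_le (hq : ∀ l, 0 ≤ q l) (hδ : 0 ≤ δ) (n : ℕ) (ω : Ω) :
    ∑ l ∈ Finset.range n, q l * truncated q δ ξ l ω ^ 2 ≤ δ := by
  -- The bound by the full energy is carried along: when index `n` is kept, it is the full energy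
  -- through `n` that is known to be at most `δ`.
  suffices h : ∑ l ∈ Finset.range n, q l * truncated q δ ξ l ω ^ 2
      ≤ min δ (∑ l ∈ Finset.range n, q l * ξ l ω ^ 2) from h.trans (min_le_left _ _)
  induction n with
  | zero => simp [hδ]
  | succ n ih =>
    obtain ⟨h1, h2⟩ := le_min_iff.1 ih
    have hn : 0 ≤ q n * ξ n ω ^ 2 := mul_nonneg (hq n) (sq_nonneg _)
    rw [Finset.sum_range_succ]
    by_cases hc : q n ≠ 0 ∧ ∑ j ∈ Finset.range (n + 1), q j * ξ j ω ^ 2 ≤ δ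
    · rw [truncated, if_pos hc]
      have := hc.2
      rw [Finset.sum_range_succ] at this ⊢
      exact le_min (by linarith) (by linarith)
    · rw [truncated, if_neg hc, Finset.sum_range_succ]
      exact le_min (by linarith) (by linarith)

lemma truncated_eq (hq : ∀ l, 0 ≤ q l) {n l : ℕ} (hl : l < n) {ω : Ω}
    (h : ∑ j ∈ Finset.range n, q j * ξ j ω ^ 2 ≤ δ) (hql : q l ≠ 0) :
    truncated q δ ξ l ω = ξ l ω := by
  refine if_pos ⟨hql, le_trans ?_ h⟩
  exact Finset.sum_le_sum_of_subset_of_nonneg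
    (Finset.range_subset_range.2 (by omega)) fun j _ _ => mul_nonneg (hq j) (sq_nonneg _)

end truncated

/-! ### Discrete stochastic integrals and Lenglart's inequality -/

section DiscreteMartingale

variable {Ω : Type*} [mΩ : MeasurableSpace Ω] {P : Measure Ω}

/-- Increments `D l`, measurable with respect to `G (l + 1)`, independent of `G l`, centred, and
with second moment at most `q l`. -/
structure IsIndepIncrements (P : Measure Ω) (G : ℕ → MeasurableSpace Ω) (D : ℕ → Ω → ℝ)
    (q : ℕ → ℝ) : Prop where
  mono : Monotone G
  le : ∀ l, G l ≤ mΩ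
  meas : ∀ l, Measurable[G (l + 1)] (D l)
  indep : ∀ l, Indep (MeasurableSpace.comap (D l) inferInstance) (G l) P
  memLp : ∀ l, MemLp (D l) 2 P
  mean : ∀ l, ∫ ω, D l ω ∂P = 0
  nonneg : ∀ l, 0 ≤ q l
  sq_le : ∀ l, ∫ ω, D l ω ^ 2 ∂P ≤ q l
  zero : ∀ l, q l = 0 → ∀ ω, D l ω = 0

namespace IsIndepIncrements

variable {G : ℕ → MeasurableSpace Ω} {D : ℕ → Ω → ℝ} {q : ℕ → ℝ}

lemma indepFun (h : IsIndepIncrements P G D q) {l : ℕ} {f : Ω → ℝ} (hf : Measurable[G l] f) :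
    IndepFun f (D l) P := by
  rw [IndepFun_iff_Indep]
  exact (indep_of_indep_of_le_right (h.indep l) hf.comap_le).symm

lemma measurable_sum (h : IsIndepIncrements P G D q) {ξ : ℕ → Ω → ℝ}
    (hξ : ∀ l, Measurable[G l] (ξ l)) (n : ℕ) :
    Measurable[G n] fun ω => ∑ l ∈ Finset.range n, ξ l ω * D l ω := by
  refine Finset.measurable_fun_sum _ fun l hl => ?_
  have hl' : l + 1 ≤ n := Finset.mem_range.1 hl
  exact ((hξ l).mono (h.mono (by omega)) le_rfl).mul ((h.meas l).mono (h.mono hl') le_rfl)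

lemma memLp_sum (h : IsIndepIncrements P G D q) {ξ : ℕ → Ω → ℝ}
    (hξ : ∀ l, Measurable[G l] (ξ l)) (hb : ∀ l, ∃ C : ℝ, ∀ ω, |ξ l ω| ≤ C) (n : ℕ) :
    MemLp (fun ω => ∑ l ∈ Finset.range n, ξ l ω * D l ω) 2 P := by
  refine memLp_finsetSum _ fun l _ => ?_
  obtain ⟨C, hC⟩ := hb l
  refine (h.memLp l).of_le_mul (c := C)
    (((hξ l).mono (h.le l) le_rfl).aestronglyMeasurable.mul (h.memLp l).1)
    (Eventually.of_forall fun ω => ?_)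
  rw [norm_mul]
  exact mul_le_mul_of_nonneg_right (hC ω) (norm_nonneg _)

variable [IsProbabilityMeasure P]

/-- Itô isometry, as an inequality, for discrete stochastic integrals with bounded integrands. -/
lemma integral_sq_sum_le (h : IsIndepIncrements P G D q) {ξ : ℕ → Ω → ℝ}
    (hξ : ∀ l, Measurable[G l] (ξ l)) (hb : ∀ l, ∃ C : ℝ, ∀ ω, |ξ l ω| ≤ C) (n : ℕ) :
    ∫ ω, (∑ l ∈ Finset.range n, ξ l ω * D l ω) ^ 2 ∂P
      ≤ ∑ l ∈ Finset.range n, q l * ∫ ω, ξ l ω ^ 2 ∂P := by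
  induction n with
  | zero => simp
  | succ n ih =>
    have hξm : ∀ l, MemLp (ξ l) 2 P := fun l => by
      obtain ⟨C, hC⟩ := hb l
      exact MemLp.of_bound ((hξ l).mono (h.le l) le_rfl).aestronglyMeasurable C
        (Eventually.of_forall hC)
    have hAm := h.measurable_sum hξ n
    have hA := h.memLp_sum hξ hb n
    set A : Ω → ℝ := fun ω => ∑ l ∈ Finset.range n, ξ l ω * D l ω with hAdef
    have hAξ : Integrable (fun ω => A ω * ξ n ω) P := hA.integrable_mul (hξm n)
    have hind : IndepFun (fun ω => A ω * ξ n ω) (D n) P := h.indepFun (hAm.mul (hξ n))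
    -- The past sum and `ξ n` are both known before the centred increment `D n`, so the cross term
    -- vanishes and only squares accumulate.
    have hcross : ∫ ω, (A ω * ξ n ω) * D n ω ∂P = 0 := by
      rw [hind.integral_fun_mul_eq_mul_integral hAξ.1 (h.memLp n).1, h.mean, mul_zero]
    have hcrossi : Integrable (fun ω => (A ω * ξ n ω) * D n ω) P :=
      hind.integrable_mul hAξ ((h.memLp n).integrable (by norm_num))
    have hind2 : IndepFun (fun ω => ξ n ω ^ 2) (fun ω => D n ω ^ 2) P :=
      (h.indepFun (hξ n)).comp (measurable_id.pow_const 2) (measurable_id.pow_const 2)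
    have hsq : ∫ ω, ξ n ω ^ 2 * D n ω ^ 2 ∂P = (∫ ω, ξ n ω ^ 2 ∂P) * ∫ ω, D n ω ^ 2 ∂P :=
      hind2.integral_fun_mul_eq_mul_integral (hξm n).integrable_sq.1 (h.memLp n).integrable_sq.1
    have hsqi : Integrable (fun ω => ξ n ω ^ 2 * D n ω ^ 2) P :=
      hind2.integrable_mul (hξm n).integrable_sq (h.memLp n).integrable_sq
    have hexp : ∀ ω, (∑ l ∈ Finset.range (n + 1), ξ l ω * D l ω) ^ 2
        = A ω ^ 2 + 2 * ((A ω * ξ n ω) * D n ω) + ξ n ω ^ 2 * D n ω ^ 2 := fun ω => by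
      rw [Finset.sum_range_succ, hAdef]; ring
    simp_rw [hexp]
    have h1 : Integrable (fun ω => A ω ^ 2 + 2 * ((A ω * ξ n ω) * D n ω)) P :=
      hA.integrable_sq.add (hcrossi.const_mul 2)
    rw [integral_add h1 hsqi, integral_add hA.integrable_sq (hcrossi.const_mul 2),
      integral_const_mul, hcross, hsq, Finset.sum_range_succ, mul_comm (q n)]
    have := mul_le_mul_of_nonneg_left (h.sq_le n)
      (integral_nonneg fun ω => sq_nonneg (ξ n ω) : 0 ≤ ∫ ω, ξ n ω ^ 2 ∂P)
    linarith

end IsIndepIncrements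

/-- Lenglart's inequality for discrete stochastic integrals. -/
lemma IsIndepIncrements.measure_le [IsProbabilityMeasure P] {G : ℕ → MeasurableSpace Ω}
    {D : ℕ → Ω → ℝ} {q : ℕ → ℝ} (h : IsIndepIncrements P G D q) {ξ : ℕ → Ω → ℝ}
    (hξ : ∀ l, Measurable[G l] (ξ l)) {κ : Type*} (s : Finset κ) (w : κ → ℕ → ℝ)
    (hw : ∀ l, ∑ k ∈ s, w k l ^ 2 ≤ 1) (n : ℕ) {δ ε : ℝ} (hδ : 0 ≤ δ) (hε : 0 < ε) :
    P {ω | ε ≤ ∑ k ∈ s, (∑ l ∈ Finset.range n, w k l * ξ l ω * D l ω) ^ 2}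
      ≤ P {ω | δ < ∑ l ∈ Finset.range n, q l * ξ l ω ^ 2} + ENNReal.ofReal (δ / ε) := by
  -- The truncated integrand has energy at most `δ` surely, so the isometry and Markov's inequality
  -- yield `δ / ε`; the event where the full energy exceeds `δ` is paid for by the first term. A
  -- single weight 1 gives the square of a sum, and indicators of disjoint blocks give a sum of
  -- squares over blocks.
  set ξ' := truncated q δ ξ
  set Z : Ω → ℝ := fun ω => ∑ k ∈ s, (∑ l ∈ Finset.range n, w k l * ξ' l ω * D l ω) ^ 2
  have hξ'b : ∀ l, ∃ C : ℝ, ∀ ω, |ξ' l ω| ≤ C := truncated_bdd h.nonneg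
  have hξ'm : ∀ l, Measurable[G l] (ξ' l) := truncated_measurable h.mono hξ
  have hb : ∀ k l, ∃ C : ℝ, ∀ ω, |w k l * ξ' l ω| ≤ C := fun k l => by
    obtain ⟨C, hC⟩ := hξ'b l
    exact ⟨|w k l| * C, fun ω => by
      rw [abs_mul]; exact mul_le_mul_of_nonneg_left (hC ω) (abs_nonneg _)⟩
  have hm : ∀ k l, Measurable[G l] fun ω => w k l * ξ' l ω := fun k l => (hξ'm l).const_mul _
  have hi : ∀ k, Integrable
      (fun ω => (∑ l ∈ Finset.range n, w k l * ξ' l ω * D l ω) ^ 2) P := fun k =>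
    (h.memLp_sum (hm k) (hb k) n).integrable_sq
  have hZi : Integrable Z P := integrable_finsetSum _ fun k _ => hi k
  have hsqi : ∀ l, Integrable (fun ω => ξ' l ω ^ 2) P := fun l => by
    obtain ⟨C, hC⟩ := hξ'b l
    exact (MemLp.of_bound (p := 2) ((hξ'm l).mono (h.le l) le_rfl).aestronglyMeasurable C
      (Eventually.of_forall hC)).integrable_sq
  have hZ : ∫ ω, Z ω ∂P ≤ δ := by
    calc ∫ ω, Z ω ∂P
        = ∑ k ∈ s, ∫ ω, (∑ l ∈ Finset.range n, w k l * ξ' l ω * D l ω) ^ 2 ∂P :=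
          integral_finsetSum _ fun k _ => hi k
      _ ≤ ∑ k ∈ s, ∑ l ∈ Finset.range n, q l * ∫ ω, (w k l * ξ' l ω) ^ 2 ∂P :=
          Finset.sum_le_sum fun k _ => h.integral_sq_sum_le (hm k) (hb k) n
      _ = ∑ l ∈ Finset.range n, (∑ k ∈ s, w k l ^ 2) * (q l * ∫ ω, ξ' l ω ^ 2 ∂P) := by
          rw [Finset.sum_comm]
          refine Finset.sum_congr rfl fun l _ => ?_
          rw [Finset.sum_mul]
          refine Finset.sum_congr rfl fun k _ => ?_
          simp_rw [mul_pow]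
          rw [integral_const_mul]; ring
      _ ≤ ∑ l ∈ Finset.range n, q l * ∫ ω, ξ' l ω ^ 2 ∂P :=
          Finset.sum_le_sum fun l _ => mul_le_of_le_one_left
            (mul_nonneg (h.nonneg l) (integral_nonneg fun ω => sq_nonneg _)) (hw l)
      _ = ∫ ω, ∑ l ∈ Finset.range n, q l * ξ' l ω ^ 2 ∂P := by
          rw [integral_finsetSum _ fun l _ => (hsqi l).const_mul _]
          simp_rw [integral_const_mul]
      _ ≤ ∫ _, δ ∂P := integral_mono
          (integrable_finsetSum _ fun l _ => (hsqi l).const_mul _) (integrable_const _)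
          fun ω => sum_truncated_le h.nonneg hδ n ω
      _ = δ := by simp
  have hmarkov : P {ω | ε ≤ Z ω} ≤ ENNReal.ofReal (δ / ε) := by
    have h1 := mul_meas_ge_le_integral_of_nonneg
      (Eventually.of_forall fun ω => Finset.sum_nonneg fun k _ => sq_nonneg _) hZi ε
    rw [← ofReal_measureReal (μ := P) (s := {ω | ε ≤ Z ω})]
    refine ENNReal.ofReal_le_ofReal ?_
    rw [le_div_iff₀ hε, mul_comm]
    exact h1.trans hZ
  refine (measure_mono ?_).trans ((measure_union_le _ _).trans (by gcongr))
  intro ω hω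
  by_cases hc : δ < ∑ l ∈ Finset.range n, q l * ξ l ω ^ 2
  · exact Or.inl hc
  · refine Or.inr ?_
    simp only [Set.mem_ofPred_eq] at hω ⊢
    convert! hω using 1
    refine Finset.sum_congr rfl fun k _ => ?_
    congr 1
    refine Finset.sum_congr rfl fun l hl => ?_
    -- Truncation also erases `ξ l` when `q l = 0`, harmlessly, since the increment is zero there.
    by_cases hql : q l = 0
    · simp [h.zero l hql]
    · rw [show ξ' l ω = ξ l ω from
        truncated_eq h.nonneg (Finset.mem_range.1 hl) (not_lt.1 hc) hql]

/-- Discrete stochastic integrals converge to zero in probability when the integrals of the squares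
of their integrands converge to zero almost surely. -/
lemma IsIndepIncrements.tendstoInMeasure_zero [IsProbabilityMeasure P]
    {G : ℕ → ℕ → MeasurableSpace Ω} {D : ℕ → ℕ → Ω → ℝ} {q : ℕ → ℕ → ℝ}
    (h : ∀ m, IsIndepIncrements P (G m) (D m) (q m)) {ξ : ℕ → ℕ → Ω → ℝ}
    (hξ : ∀ m l, Measurable[G m l] (ξ m l)) {κ : Type*} (s : ℕ → Finset κ)
    (w : ℕ → κ → ℕ → ℝ) (hw : ∀ m l, ∑ k ∈ s m, w m k l ^ 2 ≤ 1) (n : ℕ → ℕ)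
    (hc : ∀ᵐ ω ∂P, Tendsto (fun m => ∑ l ∈ Finset.range (n m), q m l * ξ m l ω ^ 2)
      atTop (𝓝 0)) :
    TendstoInMeasure P
      (fun m ω => ∑ k ∈ s m, (∑ l ∈ Finset.range (n m), w m k l * ξ m l ω * D m l ω) ^ 2)
      atTop (fun _ => 0) := by
  have hcm : TendstoInMeasure P
      (fun m ω => ∑ l ∈ Finset.range (n m), q m l * ξ m l ω ^ 2) atTop (fun _ => 0) := by
    refine tendstoInMeasure_of_tendsto_ae (fun m => Measurable.aestronglyMeasurable ?_) hc
    exact Finset.measurable_fun_sum _ fun l _ =>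
      ((((hξ m l).mono ((h m).le l) le_rfl).pow_const 2).const_mul _)
  rw [tendstoInMeasure_iff_norm] at hcm ⊢
  intro ε hε
  rw [ENNReal.tendsto_nhds_zero]
  intro η hη
  obtain ⟨r, hr0, hrη⟩ : ∃ r : ℝ, 0 < r ∧ ENNReal.ofReal r ≤ η / 2 := by
    rcases eq_or_ne η ∞ with rfl | hη'
    · exact ⟨1, one_pos, by simp [ENNReal.top_div]⟩
    · refine ⟨(η / 2).toReal, ENNReal.toReal_pos (ENNReal.half_pos hη.ne').ne'
        (ENNReal.div_lt_top hη' (by simp)).ne, ENNReal.ofReal_toReal_le⟩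
  -- With the energy threshold `r * ε`, the Markov term is exactly `r`.
  have hδ : 0 < r * ε := mul_pos hr0 hε
  filter_upwards [ENNReal.tendsto_nhds_zero.1 (hcm _ hδ) (η / 2) (ENNReal.half_pos hη.ne')]
    with m hm
  have h1 := (h m).measure_le (hξ m) (s m) (w m) (hw m) (n m) hδ.le hε
  rw [mul_div_cancel_right₀ _ hε.ne'] at h1
  calc _ ≤ _ := measure_mono fun ω hω => ?_
    _ ≤ _ := h1
    _ ≤ η / 2 + η / 2 := add_le_add ((measure_mono fun ω hω => ?_).trans hm) hrη
    _ = η := ENNReal.add_halves η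
  · simp only [Set.mem_ofPred_eq, sub_zero, Real.norm_eq_abs] at hω ⊢
    rwa [abs_of_nonneg (Finset.sum_nonneg fun k _ => sq_nonneg _)] at hω
  · simp only [Set.mem_ofPred_eq, sub_zero, Real.norm_eq_abs] at hω ⊢
    exact hω.le.trans (le_abs_self _)

end DiscreteMartingale

/-! ### Time grids containing prescribed points -/

section Grid

/-- The `l`-th interval of the grid `g` is nondegenerate and lies between `a` and `b`. -/
def InBlock (g : ℕ → ℝ≥0) (a b : ℝ≥0) (l : ℕ) : Prop := a ≤ g l ∧ g l < g (l + 1) ∧ g (l + 1) ≤ b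

open Classical in
/-- The indicator of `InBlock`. -/
def blockWeight (g : ℕ → ℝ≥0) (a b : ℝ≥0) (l : ℕ) : ℝ := if InBlock g a b l then 1 else 0

/-- `a` is one of the points `g 0, …, g n`. -/
def OnGrid (g : ℕ → ℝ≥0) (n : ℕ) (a : ℝ≥0) : Prop := ∃ p ≤ n, g p = a

lemma exists_grid (G : Finset ℝ≥0) : ∃ (g : ℕ → ℝ≥0) (n : ℕ), Monotone g ∧ ∀ a ∈ G, OnGrid g n a := by
  rcases G.eq_empty_or_nonempty with rfl | hG
  · exact ⟨fun _ => 0, 0, monotone_const, by simp⟩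
  have hc : 0 < G.card := hG.card_pos
  -- Capping the index at `G.card - 1` extends the increasing enumeration of `G` to a monotone
  -- sequence, constant after its maximum.
  refine ⟨fun k => G.orderEmbOfFin rfl ⟨min k (G.card - 1), by omega⟩, G.card, ?_, ?_⟩
  · intro k l hkl
    refine (G.orderEmbOfFin rfl).monotone ?_
    simp only [Fin.mk_le_mk]
    omega
  · intro a ha
    have : a ∈ Set.range (G.orderEmbOfFin rfl) := by
      rw [Finset.range_orderEmbOfFin]; exact ha
    obtain ⟨p, rfl⟩ := this
    have hp := p.2
    refine ⟨p, hp.le, congrArg _ (Fin.ext ?_)⟩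
    exact min_eq_left (by omega)

variable {g : ℕ → ℝ≥0} {n : ℕ} {a b : ℝ≥0}

lemma OnGrid.le_or_le (hg : Monotone g) (ha : OnGrid g n a) (l : ℕ) : g (l + 1) ≤ a ∨ a ≤ g l := by
  obtain ⟨p, -, rfl⟩ := ha
  rcases Nat.lt_or_ge l p with h | h
  · exact Or.inl (hg h)
  · exact Or.inr (hg h)

/-- Telescoping between two grid points; degenerate intervals have weight 0, but their increments
vanish anyway. -/
lemma sum_blockWeight (hg : Monotone g) (ha : OnGrid g n a) (hb : OnGrid g n b) (hab : a ≤ b)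
    (φ : ℝ≥0 → ℝ) :
    ∑ l ∈ Finset.range n, blockWeight g a b l * (φ (g (l + 1)) - φ (g l)) = φ b - φ a := by
  obtain ⟨p, hp, rfl⟩ := ha
  obtain ⟨q, hq, rfl⟩ := hb
  rcases le_or_gt p q with hpq | hpq
  · rw [← Finset.sum_Ico_sub (fun k => φ (g k)) hpq]
    symm
    have hsub : Finset.Ico p q ⊆ Finset.range n := fun l hl => by
      rw [Finset.mem_Ico] at hl; exact Finset.mem_range.2 (by omega)
    refine Finset.sum_subset_zero_on_sdiff hsub (fun l hl => ?_) fun l hl => ?_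
    · rw [Finset.mem_sdiff, Finset.mem_Ico] at hl
      have hnot : ¬ InBlock g (g p) (g q) l := fun ⟨h1, h2, h3⟩ => by
        refine hl.2 ⟨?_, ?_⟩
        · by_contra hc
          exact absurd (hg (show l + 1 ≤ p by omega)) (not_le.2 (h1.trans_lt h2))
        · by_contra hc
          exact absurd (hg (show q ≤ l by omega)) (not_le.2 (h2.trans_le h3))
      simp [blockWeight, hnot]
    · rw [Finset.mem_Ico] at hl
      rcases (hg (Nat.le_succ l)).eq_or_lt with h | h
      · simp [← h]
      · have : InBlock g (g p) (g q) l := ⟨hg hl.1, h, hg (by omega)⟩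
        simp [blockWeight, this]
  -- Repeated grid points can make the chosen indices come in the wrong order; then `a = b` and no
  -- nondegenerate interval fits between them.
  · have heq : g p = g q := le_antisymm hab (hg hpq.le)
    rw [heq, sub_self]
    refine Finset.sum_eq_zero fun l _ => ?_
    have hnot : ¬ InBlock g (g q) (g q) l := fun ⟨h1, h2, h3⟩ =>
      absurd (h1.trans_lt h2) (not_lt.2 h3)
    simp [blockWeight, hnot]

end Grid

/-! ### Algebra of simple processes -/

section Simple

variable {Ω : Type*} [mΩ : MeasurableSpace Ω] {𝓕 : Filtration ℝ≥0 mΩ}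

/-- A finite sum of elementary integrands `ξ_i 1_{(a_i, b_i]}` is a simple process, on a grid that
contains prescribed points. -/
lemma exists_simpleProcess {I : Type*} [Fintype I] (a b : I → ℝ≥0) (hab : ∀ i, a i ≤ b i)
    (ξ : I → Ω → ℝ) (hm : ∀ i, Measurable[𝓕 (a i)] (ξ i))
    (hb : ∀ i, ∃ C : ℝ, ∀ ω, |ξ i ω| ≤ C) (T : Finset ℝ≥0) :
    ∃ U : SimpleProcess 𝓕,
      (∀ t ω, U.eval t ω = ∑ i, (Set.Ioc (a i) (b i)).indicator (fun _ => ξ i ω) t) ∧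
      (∀ W t ω, U.integral W t ω
        = ∑ i, ξ i ω * (W (min t (b i)) ω - W (min t (a i)) ω)) ∧
      ∀ x ∈ T, OnGrid U.time U.n x := by
  classical
  obtain ⟨g, n, hg, hG⟩ := exists_grid (T ∪ (Finset.univ.image a ∪ Finset.univ.image b))
  have ha : ∀ i, OnGrid g n (a i) := fun i => hG _ (by simp)
  have hb' : ∀ i, OnGrid g n (b i) := fun i => hG _ (by simp)
  -- One telescoping identity serves twice: `φ` is the indicator of `t ≤ ·` for the values of the
  -- process, and `W (min t ·)` for its integral.
  have key : ∀ (φ : ℝ≥0 → ℝ) (ω : Ω),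
      ∑ l ∈ Finset.range n, (∑ i, blockWeight g (a i) (b i) l * ξ i ω) * (φ (g (l + 1)) - φ (g l))
        = ∑ i, ξ i ω * (φ (b i) - φ (a i)) := fun φ ω => by
    simp_rw [Finset.sum_mul]
    rw [Finset.sum_comm]
    refine Finset.sum_congr rfl fun i _ => ?_
    rw [← sum_blockWeight hg (ha i) (hb' i) (hab i) φ, Finset.mul_sum]
    exact Finset.sum_congr rfl fun l _ => by ring
  have hind : ∀ (x y t : ℝ≥0) (c : ℝ), x ≤ y → (Set.Ioc x y).indicator (fun _ => c) t
      = c * ((if t ≤ y then 1 else 0) - (if t ≤ x then 1 else 0)) := fun x y t c hxy => by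
    by_cases h1 : t ≤ x
    · simp [h1, h1.trans hxy, Set.indicator, not_lt.2 h1]
    · by_cases h2 : t ≤ y <;> simp [h1, h2, Set.indicator, not_le.1 h1]
  refine ⟨⟨n, g, hg, fun l ω => ∑ i, blockWeight g (a i) (b i) l * ξ i ω, fun l => ?_, fun l => ?_⟩,
    fun t ω => ?_, fun W t ω => ?_, fun x hx => hG x (by simp [hx])⟩
  · refine Finset.measurable_fun_sum _ fun i _ => ?_
    by_cases h : InBlock g (a i) (b i) l
    · exact ((hm i).mono (𝓕.mono h.1) le_rfl).const_mul _
    · simp only [blockWeight, h, if_false, zero_mul]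
      exact measurable_const
  · choose C hC using hb
    refine ⟨∑ i, |blockWeight g (a i) (b i) l| * C i, fun ω => ?_⟩
    refine (Finset.abs_sum_le_sum_abs _ _).trans (Finset.sum_le_sum fun i _ => ?_)
    rw [abs_mul]
    exact mul_le_mul_of_nonneg_left (hC i ω) (abs_nonneg _)
  · simp only [SimpleProcess.eval]
    rw [Finset.sum_congr rfl fun l _ => hind _ _ _ _ (hg (Nat.le_succ l)),
      Finset.sum_congr rfl fun i _ => hind _ _ _ _ (hab i)]
    exact key (fun x => if t ≤ x then 1 else 0) ω
  · exact key (fun x => W (min t x) ω) ω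

namespace SimpleProcess

/-- Lets partition points be put on the grid of a simple process, so that its integral over a
partition interval is a sum over whole grid intervals. -/
lemma exists_refinement (S : SimpleProcess 𝓕) (T : Finset ℝ≥0) :
    ∃ U : SimpleProcess 𝓕, (∀ t ω, U.eval t ω = S.eval t ω) ∧
      (∀ W t ω, U.integral W t ω = S.integral W t ω) ∧ ∀ x ∈ T, OnGrid U.time U.n x := by
  obtain ⟨U, h1, h2, h3⟩ := exists_simpleProcess (𝓕 := 𝓕) (I := Fin S.n) (fun k => S.time k)
    (fun k => S.time (k + 1)) (fun k => S.mono (Nat.le_succ _)) (fun k => S.ξ k)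
    (fun k => S.meas k) (fun k => S.bdd k) T
  refine ⟨U, fun t ω => ?_, fun W t ω => ?_, h3⟩
  · rw [h1, eval, Finset.sum_range]
  · rw [h2, integral, Finset.sum_range]

lemma exists_linearCombination {I : Type*} [Fintype I] (S : I → SimpleProcess 𝓕) (c : I → ℝ) :
    ∃ U : SimpleProcess 𝓕, (∀ t ω, U.eval t ω = ∑ i, c i * (S i).eval t ω) ∧
      ∀ W t ω, U.integral W t ω = ∑ i, c i * (S i).integral W t ω := by
  obtain ⟨U, h1, h2, -⟩ := exists_simpleProcess (𝓕 := 𝓕) (I := Σ i : I, Fin (S i).n)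
    (fun k => (S k.1).time k.2) (fun k => (S k.1).time (k.2 + 1))
    (fun k => (S k.1).mono (Nat.le_succ _)) (fun k ω => c k.1 * (S k.1).ξ k.2 ω)
    (fun k => ((S k.1).meas k.2).const_mul _)
    (fun k => by
      obtain ⟨C, hC⟩ := (S k.1).bdd k.2
      refine ⟨|c k.1| * C, fun ω => ?_⟩
      rw [abs_mul]
      exact mul_le_mul_of_nonneg_left (hC ω) (abs_nonneg _)) ∅
  refine ⟨U, fun t ω => ?_, fun W t ω => ?_⟩
  · rw [h1, Fintype.sum_sigma]
    refine Finset.sum_congr rfl fun i _ => ?_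
    rw [eval, Finset.sum_range, Finset.mul_sum]
    refine Finset.sum_congr rfl fun k _ => ?_
    simp only [Set.indicator]
    split_ifs <;> simp
  · rw [h2, Fintype.sum_sigma]
    refine Finset.sum_congr rfl fun i _ => ?_
    rw [integral, Finset.sum_range, Finset.mul_sum]
    exact Finset.sum_congr rfl fun k _ => by ring

lemma integral_zero (S : SimpleProcess 𝓕) (W : ℝ≥0 → Ω → ℝ) (ω : Ω) : S.integral W 0 ω = 0 := by
  simp [integral]

lemma measurable_eval (S : SimpleProcess 𝓕) (ω : Ω) :
    Measurable fun s : ℝ => S.eval s.toNNReal ω := by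
  unfold eval
  refine Finset.measurable_fun_sum _ fun k _ => ?_
  exact (measurable_const.indicator measurableSet_Ioc).comp measurable_real_toNNReal

lemma eval_eq (S : SimpleProcess 𝓕) {l : ℕ} (hl : l < S.n) {s : ℝ≥0}
    (hs : s ∈ Set.Ioc (S.time l) (S.time (l + 1))) (ω : Ω) : S.eval s ω = S.ξ l ω := by
  unfold eval
  rw [Finset.sum_eq_single l]
  · simp [hs.1, hs.2]
  · intro k _ hkl
    refine Set.indicator_of_notMem (fun hk => ?_) _
    exact Set.disjoint_left.1 (S.mono.pairwise_disjoint_on_Ioc_succ hkl) hk hs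
  · intro h
    exact absurd (Finset.mem_range.2 hl) h

/-- Grid points never cut a grid interval, so each interval contributes its whole increment or
nothing. -/
lemma integral_sub_integral (S : SimpleProcess 𝓕) {a b : ℝ≥0} (ha : OnGrid S.time S.n a)
    (hb : OnGrid S.time S.n b) (hab : a ≤ b) (W : ℝ≥0 → Ω → ℝ) (ω : Ω) :
    S.integral W b ω - S.integral W a ω = ∑ l ∈ Finset.range S.n,
      blockWeight S.time a b l * (S.ξ l ω * (W (S.time (l + 1)) ω - W (S.time l) ω)) := by
  unfold integral
  rw [← Finset.sum_sub_distrib]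
  refine Finset.sum_congr rfl fun l _ => ?_
  have hl := S.mono (Nat.le_succ l)
  rcases hl.eq_or_lt with h | h
  · simp only [Nat.succ_eq_add_one] at h
    simp [← h]
  rcases ha.le_or_le S.mono l with h1 | h1
  · have hnot : ¬ InBlock S.time a b l := fun h' => absurd (h1.trans h'.1) (not_le.2 h)
    simp [blockWeight, hnot, min_eq_right h1, min_eq_right (hl.trans h1),
      min_eq_right (h1.trans hab), min_eq_right ((hl.trans h1).trans hab)]
  rcases hb.le_or_le S.mono l with h2 | h2
  · have : InBlock S.time a b l := ⟨h1, h, h2⟩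
    simp only [blockWeight, this, if_true, min_eq_right h2, min_eq_right (hl.trans h2),
      min_eq_left h1, min_eq_left (h1.trans hl)]
    ring
  · have hnot : ¬ InBlock S.time a b l := fun h' => absurd (h'.2.2.trans h2) (not_le.2 h)
    simp [blockWeight, hnot, min_eq_left h1, min_eq_left (h1.trans hl), min_eq_left h2,
      min_eq_left (h2.trans hl)]

end SimpleProcess

end Simple

/-! ### Linearity of the Itô integral -/

section LinearCombination

variable {Ω : Type*} [mΩ : MeasurableSpace Ω] {P : Measure Ω} {𝓕 : Filtration ℝ≥0 mΩ}

/-- Pigeonhole and a union bound: if the weighted sum reaches `ε`, some weighted term reaches `ε`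
divided by the number of terms. -/
lemma tendsto_measure_le_sum {I : Type*} [Fintype I] {J : I → ℕ → Ω → ℝ≥0∞} {C : I → ℝ≥0∞}
    (hC : ∀ i, C i ≠ ∞)
    (h : ∀ i, ∀ ε : ℝ≥0∞, 0 < ε → Tendsto (fun m => P {ω | ε ≤ J i m ω}) atTop (𝓝 0))
    {ε : ℝ≥0∞} (hε : 0 < ε) :
    Tendsto (fun m => P {ω | ε ≤ ∑ i, C i * J i m ω}) atTop (𝓝 0) := by
  set r : I → ℝ≥0∞ := fun i => ε / Fintype.card I / C i
  have hr : ∀ i, 0 < r i := fun i =>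
    ENNReal.div_pos (ENNReal.div_pos hε.ne' (by simp)).ne' (hC i)
  have hsum : Tendsto (fun m => ∑ i, P {ω | r i ≤ J i m ω}) atTop (𝓝 0) := by
    simpa using tendsto_finsetSum (Finset.univ : Finset I) fun i _ => h i (r i) (hr i)
  refine tendsto_of_tendsto_of_tendsto_of_le_of_le tendsto_const_nhds hsum (fun _ => zero_le) ?_
  intro m
  refine (measure_mono ?_).trans (measure_biUnion_finset_le Finset.univ _)
  intro ω hω
  simp only [Set.mem_ofPred_eq] at hω
  rcases isEmpty_or_nonempty I with hI | hI
  · simp [hε.ne'] at hω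
  have hcard : ∑ _i : I, ε / Fintype.card I = ε := by
    rw [Finset.sum_const, Finset.card_univ, nsmul_eq_mul]
    exact ENNReal.mul_div_cancel (by simp) (by simp)
  obtain ⟨i, hi⟩ : ∃ i, ε / Fintype.card I ≤ C i * J i m ω := by
    by_contra! hlt
    refine absurd hω (not_le.2 ?_)
    rw [← hcard]
    exact ENNReal.sum_lt_sum_of_nonempty Finset.univ_nonempty fun i _ => hlt i
  refine Set.mem_iUnion₂.2 ⟨i, Finset.mem_univ i, ?_⟩
  exact ENNReal.div_le_of_le_mul' hi

/-- Linearity of the Itô integral. -/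
lemma IsItoIntegral.linearCombination {I : Type*} [Fintype I] {W : ℝ≥0 → Ω → ℝ}
    {H M : I → ℝ≥0 → Ω → ℝ} (h : ∀ i, IsItoIntegral P 𝓕 W (H i) (M i))
    (hH : ∀ i, ∀ᵐ ω ∂P, Continuous fun t => H i t ω) (c : I → ℝ) :
    IsItoIntegral P 𝓕 W (fun t ω => ∑ i, c i * H i t ω) (fun t ω => ∑ i, c i * M i t ω) := by
  choose S hS using h
  choose U hU1 hU2 using fun m =>
    SimpleProcess.exists_linearCombination (fun i => S i m) c
  refine ⟨U, fun t => ⟨fun ε hε => ?_, ?_⟩⟩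
  -- The constants come from Cauchy–Schwarz: the square of a sum is at most the number of terms
  -- times the sum of squares.
  · have h0 := tendsto_measure_le_sum (P := P)
      (C := fun i => ENNReal.ofReal (Fintype.card I * c i ^ 2)) (fun i => ENNReal.ofReal_ne_top)
      (fun i ε hε => (hS i t).1 ε hε) hε
    refine tendsto_of_tendsto_of_tendsto_of_le_of_le tendsto_const_nhds h0 (fun _ => zero_le) ?_
    intro m
    refine measure_mono_ae ?_
    filter_upwards [ae_all_iff.2 hH] with ω hω hle
    refine le_trans (α := ℝ≥0∞) hle ?_
    have hmeas : ∀ i, Measurable fun s : ℝ =>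
        ENNReal.ofReal (((S i m).eval s.toNNReal ω - H i s.toNNReal ω) ^ 2) := fun i =>
      ((((S i m).measurable_eval ω).sub
        ((hω i).measurable.comp measurable_real_toNNReal)).pow_const 2).ennreal_ofReal
    calc ∫⁻ s in Set.Icc (0 : ℝ) t,
          ENNReal.ofReal (((U m).eval s.toNNReal ω - ∑ i, c i * H i s.toNNReal ω) ^ 2)
        ≤ ∫⁻ s in Set.Icc (0 : ℝ) t, ∑ i, ENNReal.ofReal (Fintype.card I * c i ^ 2) *
          ENNReal.ofReal (((S i m).eval s.toNNReal ω - H i s.toNNReal ω) ^ 2) := by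
          refine lintegral_mono fun s => ?_
          simp_rw [← ENNReal.ofReal_mul (show (0 : ℝ) ≤ Fintype.card I * c _ ^ 2 by positivity)]
          rw [← ENNReal.ofReal_sum_of_nonneg fun i _ => by positivity]
          refine ENNReal.ofReal_le_ofReal ?_
          rw [hU1, ← Finset.sum_sub_distrib]
          refine (sq_sum_le_card_mul_sum_sq).trans (le_of_eq ?_)
          rw [Finset.card_univ, Finset.mul_sum]
          exact Finset.sum_congr rfl fun i _ => by ring
      _ = _ := by
          rw [lintegral_finsetSum _ fun i _ => (hmeas i).const_mul _]
          exact Finset.sum_congr rfl fun i _ => lintegral_const_mul _ (hmeas i)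
  · intro ε hε
    have h0 := tendsto_measure_le_sum (P := P) (C := fun i => ‖c i‖ₑ) (fun i => by simp)
      (fun i ε hε => (hS i t).2 ε hε) hε
    refine tendsto_of_tendsto_of_tendsto_of_le_of_le tendsto_const_nhds h0 (fun _ => zero_le) ?_
    intro m
    refine measure_mono fun ω hω => ?_
    refine le_trans (α := ℝ≥0∞) hω ?_
    simp only [hU2, edist_eq_enorm_sub, ← Finset.sum_sub_distrib]
    refine (enorm_sum_le _ _).trans (Finset.sum_le_sum fun i _ => ?_)
    rw [← mul_sub, enorm_mul]

end LinearCombination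

/-! ### Scalar Brownian motion and its compensated squares -/

section ScalarBrownianMotion

variable {Ω : Type*} [mΩ : MeasurableSpace Ω] {P : Measure Ω} {𝓕 : Filtration ℝ≥0 mΩ}

/-- The properties of a real Brownian motion relative to `𝓕` that Itô calculus uses. -/
structure IsScalarBrownianMotion (P : Measure Ω) (𝓕 : Filtration ℝ≥0 mΩ) (W : ℝ≥0 → Ω → ℝ) :
    Prop where
  adapted : ∀ t, Measurable[𝓕 t] (W t)
  indep : ∀ s t : ℝ≥0, s ≤ t →
    Indep (MeasurableSpace.comap (fun ω => W t ω - W s ω) inferInstance) (𝓕 s) P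
  law : ∀ s t : ℝ≥0, s ≤ t → HasLaw (fun ω => W t ω - W s ω) (gaussianReal 0 (t - s)) P

lemma IsBrownianMotion.coordinate {κ : Type} [Fintype κ] [DecidableEq κ] {B : ℝ≥0 → Ω → Vec κ}
    (h : IsBrownianMotion P 𝓕 B) (k : κ) : IsScalarBrownianMotion P 𝓕 fun t ω => B t ω k where
  adapted t := (EuclideanSpace.proj (𝕜 := ℝ) k).measurable.comp (h.adapted t)
  indep s t hst := by
    refine indep_of_indep_of_le_left (h.indep s t hst) ?_
    have : (fun ω => B t ω k - B s ω k)
        = (EuclideanSpace.proj (𝕜 := ℝ) k) ∘ fun ω => B t ω - B s ω := by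
      ext ω; simp
    rw [this, ← MeasurableSpace.comap_comp]
    exact MeasurableSpace.comap_mono (EuclideanSpace.proj (𝕜 := ℝ) k).measurable.comap_le
  law s t hst := by
    have hst' : (0 : ℝ) ≤ (t : ℝ) - s := sub_nonneg.2 (NNReal.coe_le_coe.2 hst)
    have hS : (((t : ℝ) - s) • (1 : Matrix κ κ ℝ)).PosSemidef := Matrix.PosSemidef.one.smul hst'
    have h1 := (measurePreserving_eval_multivariateGaussian (μ := (0 : Vec κ)) hS
      (i := k)).comp_hasLaw (h.law s t hst)
    have h2 : ((((t : ℝ) - s) • (1 : Matrix κ κ ℝ)) k k).toNNReal = t - s := by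
      simp only [Matrix.smul_apply, Matrix.one_apply_eq, smul_eq_mul, mul_one]
      rw [← NNReal.coe_sub hst, Real.toNNReal_coe]
    rw [h2] at h1
    exact h1

namespace IsScalarBrownianMotion

variable {W : ℝ≥0 → Ω → ℝ}

lemma isIndepIncrements (hW : IsScalarBrownianMotion P 𝓕 W) {g : ℕ → ℝ≥0} (hg : Monotone g) :
    IsIndepIncrements P (fun l => 𝓕 (g l)) (fun l ω => W (g (l + 1)) ω - W (g l) ω)
      (fun l => (g (l + 1) : ℝ) - g l) where
  mono := fun _ _ h => 𝓕.mono (hg h)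
  le l := 𝓕.le _
  meas l := (hW.adapted _).sub ((hW.adapted _).mono (𝓕.mono (hg (Nat.le_succ l))) le_rfl)
  indep l := hW.indep _ _ (hg (Nat.le_succ l))
  memLp l := by
    have h := hW.law _ _ (hg (Nat.le_succ l))
    have h2 := memLp_id_gaussianReal' (μ := 0) (v := g (l + 1) - g l) 2 (by simp)
    rw [← h.map_eq] at h2
    exact h2.comp_of_map h.aemeasurable
  mean l := by
    rw [(hW.law _ _ (hg (Nat.le_succ l))).integral_eq]
    exact integral_id_gaussianReal
  nonneg l := sub_nonneg.2 (NNReal.coe_le_coe.2 (hg (Nat.le_succ l)))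
  sq_le l := by
    have h := hW.law _ _ (hg (Nat.le_succ l))
    have h1 := h.integral_comp (f := fun x : ℝ => x ^ 2)
      (measurable_id.pow_const 2).aestronglyMeasurable
    have h2 : Var[fun x => x; gaussianReal 0 (g (l + 1) - g l)] = (g (l + 1) - g l : ℝ≥0) :=
      variance_fun_id_gaussianReal
    rw [variance_eq_integral (by fun_prop)] at h2
    simp only [integral_id_gaussianReal, sub_zero] at h2
    rw [h2, NNReal.coe_sub (hg (Nat.le_succ l))] at h1
    exact h1.le
  zero l hl ω := by
    have : g (l + 1) = g l := NNReal.coe_injective (sub_eq_zero.1 hl)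
    rw [this, sub_self]

/-- Brownian scaling: the centred Gaussian of variance `r` is the image of the standard one under
multiplication by `√r`. -/
lemma integral_sq_sub_sq_gaussianReal (r : ℝ≥0) :
    ∫ x, (x ^ 2 - r) ^ 2 ∂gaussianReal 0 r
      = (r : ℝ) ^ 2 * ∫ x, (x ^ 2 - 1) ^ 2 ∂gaussianReal 0 1 := by
  have hr : (gaussianReal 0 1).map (fun x => √(r : ℝ) * x) = gaussianReal 0 r := by
    rw [gaussianReal_map_const_mul]
    congr 1
    · simp
    · ext; simp
  conv_lhs => rw [← hr]
  rw [integral_map (by fun_prop) (by fun_prop), ← integral_const_mul]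
  refine integral_congr_ae (Eventually.of_forall fun x => ?_)
  have h : √(r : ℝ) ^ 2 = r := Real.sq_sqrt r.2
  simp only [mul_pow _ _ 2, h]
  ring

/-- The compensated squares (ΔW)² - Δt are again centred and independent of the past, with second
moment of order (Δt)² by scaling. This is the source of the quadratic variation. -/
lemma isIndepIncrements_sq [IsProbabilityMeasure P] (hW : IsScalarBrownianMotion P 𝓕 W) :
    ∃ K : ℝ, 0 ≤ K ∧ ∀ g : ℕ → ℝ≥0, Monotone g → IsIndepIncrements P (fun l => 𝓕 (g l))
      (fun l ω => (W (g (l + 1)) ω - W (g l) ω) ^ 2 - ((g (l + 1) : ℝ) - g l))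
      (fun l => K * ((g (l + 1) : ℝ) - g l) ^ 2) := by
  have hK : 0 ≤ ∫ x, (x ^ 2 - 1) ^ 2 ∂gaussianReal 0 1 := integral_nonneg fun x => sq_nonneg _
  -- Adding 1 makes the constant positive by inspection, so that `q l = 0` forces a degenerate
  -- interval.
  refine ⟨(∫ x, (x ^ 2 - 1) ^ 2 ∂gaussianReal 0 1) + 1, by linarith, fun g hg => ?_⟩
  have h1 := hW.isIndepIncrements hg
  have hle := fun l => hg (Nat.le_succ l)
  refine ⟨h1.mono, h1.le, fun l => ((h1.meas l).pow_const 2).sub_const _, fun l => ?_, fun l => ?_,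
    fun l => ?_, fun l => by positivity, fun l => ?_, fun l hl ω => ?_⟩
  · refine indep_of_indep_of_le_left (h1.indep l) ?_
    have : (fun ω => (W (g (l + 1)) ω - W (g l) ω) ^ 2 - ((g (l + 1) : ℝ) - g l))
        = (fun x : ℝ => x ^ 2 - ((g (l + 1) : ℝ) - g l)) ∘
          fun ω => W (g (l + 1)) ω - W (g l) ω := rfl
    rw [this, ← MeasurableSpace.comap_comp]
    exact MeasurableSpace.comap_mono
      ((measurable_id.pow_const 2).sub_const _ : Measurable fun x : ℝ => _).comap_le
  · have h := hW.law _ _ (hle l)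
    -- The increment is taken in L⁴, so that its square is in L².
    have h2 := memLp_id_gaussianReal' (μ := 0) (v := g (l + 1) - g l) 4 (by simp)
    rw [← h.map_eq] at h2
    have h3 := h2.comp_of_map h.aemeasurable
    refine MemLp.sub ?_ (memLp_const _)
    have h4 := h3.norm_rpow_div (q := 2)
    have : (4 : ℝ≥0∞) / 2 = 2 := by
      rw [show (4 : ℝ≥0∞) = 2 * 2 by norm_num]
      exact ENNReal.mul_div_cancel_right (by simp) (by simp)
    rw [this] at h4
    refine h4.congr_norm ?_ (Eventually.of_forall fun ω => ?_)
    · exact (((h1.meas l).mono (𝓕.le _) le_rfl).pow_const 2).aestronglyMeasurable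
    · simp
  · have := h1.memLp l
    rw [integral_sub this.integrable_sq (integrable_const _)]
    have h := hW.law _ _ (hle l)
    have h3 := h.integral_comp (f := fun x : ℝ => x ^ 2)
      (measurable_id.pow_const 2).aestronglyMeasurable
    have h2 : Var[fun x => x; gaussianReal 0 (g (l + 1) - g l)] = (g (l + 1) - g l : ℝ≥0) :=
      variance_fun_id_gaussianReal
    rw [variance_eq_integral (by fun_prop)] at h2
    simp only [integral_id_gaussianReal, sub_zero] at h2
    rw [h2, NNReal.coe_sub (hle l)] at h3
    have h3' : ∫ ω, (W (g (l + 1)) ω - W (g l) ω) ^ 2 ∂P = (g (l + 1) : ℝ) - g l := h3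
    rw [h3']
    simp
  · have h := hW.law _ _ (hle l)
    have h3 := h.integral_comp (f := fun x : ℝ => (x ^ 2 - ((g (l + 1) : ℝ) - g l)) ^ 2)
      (by fun_prop)
    have h4 := integral_sq_sub_sq_gaussianReal (g (l + 1) - g l)
    rw [NNReal.coe_sub (hle l)] at h4
    rw [h4] at h3
    refine (h3.le : ∫ ω, ((W (g (l + 1)) ω - W (g l) ω) ^ 2 - ((g (l + 1) : ℝ) - g l)) ^ 2 ∂P
      ≤ _).trans ?_
    have := sq_nonneg ((g (l + 1) : ℝ) - g l)
    linarith
  · have h0 : ((g (l + 1) : ℝ) - g l) ^ 2 = 0 :=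
      (mul_eq_zero.1 hl).resolve_left (by linarith)
    have h0' : (g (l + 1) : ℝ) - g l = 0 := pow_eq_zero_iff (two_ne_zero) |>.1 h0
    simp [h1.zero l h0' ω, h0']

end IsScalarBrownianMotion

end ScalarBrownianMotion

/-! ### Uniform partitions and continuous paths -/

section Partition

/-- The points `t k / (n + 1)` of the uniform partition of `[0, t]`. -/
def node (t : ℝ≥0) (n k : ℕ) : ℝ≥0 := t * (k / (n + 1))

lemma node_mono (t : ℝ≥0) (n : ℕ) : Monotone (node t n) := fun k l h => by
  unfold node; gcongr

@[simp] lemma node_zero (t : ℝ≥0) (n : ℕ) : node t n 0 = 0 := by simp [node]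

@[simp] lemma node_last (t : ℝ≥0) (n : ℕ) : node t n (n + 1) = t := by
  unfold node
  rw [Nat.cast_add_one, div_self (by positivity), mul_one]

lemma node_le {t : ℝ≥0} {n k : ℕ} (h : k ≤ n + 1) : node t n k ≤ t := by
  simpa using node_mono t n h

lemma node_succ_sub (t : ℝ≥0) (n k : ℕ) :
    (node t n (k + 1) : ℝ) - node t n k = t / (n + 1) := by
  simp only [node, NNReal.coe_mul, NNReal.coe_div, NNReal.coe_natCast, NNReal.coe_add,
    NNReal.coe_one, Nat.cast_add, Nat.cast_one]
  field_simp
  ring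

lemma tendsto_mesh (c : ℝ) : Tendsto (fun n : ℕ => c / ((n : ℝ) + 1)) atTop (𝓝 0) :=
  tendsto_const_nhds.div_atTop
    (tendsto_atTop_add_const_right _ _ tendsto_natCast_atTop_atTop)

lemma eventually_oscillation_le {f : ℝ≥0 → ℝ} (hf : Continuous f) (t : ℝ≥0) {η : ℝ} (hη : 0 < η) :
    ∀ᶠ n : ℕ in atTop, ∀ k < n + 1, ∀ s ∈ Set.Icc (node t n k) (node t n (k + 1)),
      |f s - f (node t n k)| ≤ η := by
  have huc := isCompact_Icc (a := (0 : ℝ≥0)) (b := t)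
    |>.uniformContinuousOn_of_continuous hf.continuousOn
  obtain ⟨δ, hδ, h⟩ := Metric.uniformContinuousOn_iff.1 huc η hη
  filter_upwards [(tendsto_mesh (t : ℝ)).eventually_lt_const hδ] with n hn k hk s hs
  have hs2 : s ≤ t := hs.2.trans (node_le hk)
  refine (h s ⟨zero_le, hs2⟩ _ ⟨zero_le, node_le hk.le⟩ ?_).le
  rw [NNReal.dist_eq, abs_of_nonneg (sub_nonneg.2 (NNReal.coe_le_coe.2 hs.1))]
  have h1 : (s : ℝ) ≤ node t n (k + 1) := NNReal.coe_le_coe.2 hs.2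
  have h2 := node_succ_sub t n k
  linarith

lemma exists_abs_le {f : ℝ≥0 → ℝ} (hf : Continuous f) (t : ℝ≥0) :
    ∃ K : ℝ, 0 ≤ K ∧ ∀ s ≤ t, |f s| ≤ K := by
  obtain ⟨K, hK⟩ := (isCompact_Icc (a := (0 : ℝ≥0)) (b := t)).exists_bound_of_continuousOn
    hf.continuousOn
  exact ⟨K, (norm_nonneg _).trans (hK 0 ⟨le_rfl, zero_le⟩), fun s hs => hK s ⟨zero_le, hs⟩⟩

end Partition

/-! ### Freezing the integrand on a uniform partition -/

section Residual

variable {Ω : Type*} [mΩ : MeasurableSpace Ω] {P : Measure Ω} {𝓕 : Filtration ℝ≥0 mΩ}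
  {W : ℝ≥0 → Ω → ℝ}

/-- Simple approximations of an Itô integral that converge almost surely, uniformly over the nodes
of the uniform partitions of `[0, t]`. -/
lemma IsItoIntegral.exists_approx {H M : ℝ≥0 → Ω → ℝ} (h : IsItoIntegral P 𝓕 W H M) (t : ℝ≥0) :
    ∃ S : ℕ → SimpleProcess 𝓕,
      (∀ n, ∀ k ≤ n + 1, OnGrid (S n).time (S n).n (node t n k)) ∧
      ∀ᵐ ω ∂P,
        Tendsto (fun n => ∫⁻ s in Set.Icc (0 : ℝ) t,
          ENNReal.ofReal (((S n).eval s.toNNReal ω - H s.toNNReal ω) ^ 2)) atTop (𝓝 0) ∧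
        Tendsto (fun n => ∑ k ∈ Finset.range (n + 2),
          |(S n).integral W (node t n k) ω - M (node t n k) ω|) atTop (𝓝 0) := by
  obtain ⟨S₀, hS₀⟩ := h
  -- `none` carries the error of the integrand, `some k` the error of the integral at the `k`-th of
  -- the `n + 2` nodes.
  let J : (n m : ℕ) → Ω → ℝ≥0∞ := fun n m ω => ∑ i : Option (Fin (n + 2)), 1 *
    (i.elim (∫⁻ s in Set.Icc (0 : ℝ) t,
      ENNReal.ofReal (((S₀ m).eval s.toNNReal ω - H s.toNNReal ω) ^ 2))
      fun k => edist ((S₀ m).integral W (node t n k) ω) (M (node t n k) ω))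
  have hJ : ∀ n, ∃ m, P {ω | (2⁻¹ : ℝ≥0∞) ^ n ≤ J n m ω} ≤ (2⁻¹ : ℝ≥0∞) ^ n := fun n => by
    have hpos : (0 : ℝ≥0∞) < 2⁻¹ ^ n := ENNReal.pow_pos (by simp) n
    have := tendsto_measure_le_sum (P := P) (I := Option (Fin (n + 2)))
      (J := fun i m ω => i.elim (∫⁻ s in Set.Icc (0 : ℝ) t,
        ENNReal.ofReal (((S₀ m).eval s.toNNReal ω - H s.toNNReal ω) ^ 2))
        fun k => edist ((S₀ m).integral W (node t n k) ω) (M (node t n k) ω))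
      (C := fun _ => 1) (fun _ => by simp)
      (fun i ε hε => by
        cases i with
        | none => exact (hS₀ t).1 ε hε
        | some k => exact (hS₀ (node t n k)).2 ε hε) hpos
    exact (ENNReal.tendsto_nhds_zero.1 this _ hpos).exists
  choose m hm using hJ
  choose S hS1 hS2 hS3 using fun n => SimpleProcess.exists_refinement (S₀ (m n))
    ((Finset.range (n + 2)).image (node t n))
  refine ⟨S, fun n k hk => hS3 n _ (Finset.mem_image_of_mem _ (Finset.mem_range.2 (by omega))), ?_⟩
  -- Borel–Cantelli: for the chosen `m n`, the total error is almost surely below `2⁻¹ ^ n` for all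
  -- large `n`.
  have hsum : ∑' n, P {ω | (2⁻¹ : ℝ≥0∞) ^ n ≤ J n (m n) ω} ≠ ∞ := by
    refine ne_top_of_le_ne_top ?_ (ENNReal.tsum_le_tsum hm)
    rw [ENNReal.tsum_geometric]
    simp
  have hpow : Tendsto (fun n : ℕ => (2⁻¹ : ℝ≥0∞) ^ n) atTop (𝓝 0) :=
    ENNReal.tendsto_pow_atTop_nhds_zero_of_lt_one (by simp)
  filter_upwards [ae_eventually_notMem hsum] with ω hω
  have hJ0 : Tendsto (fun n => J n (m n) ω) atTop (𝓝 0) := by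
    refine tendsto_of_tendsto_of_tendsto_of_le_of_le' tendsto_const_nhds hpow
      (Eventually.of_forall fun _ => zero_le) ?_
    filter_upwards [hω] with n hn
    exact (not_le.1 hn).le
  simp only [J, one_mul, Fintype.sum_option, Option.elim] at hJ0
  constructor
  · refine tendsto_of_tendsto_of_tendsto_of_le_of_le tendsto_const_nhds hJ0 (fun _ => zero_le) ?_
    intro n
    simp only [hS1]
    exact le_self_add
  · have h1 : Tendsto (fun n => ∑ k : Fin (n + 2),
        edist ((S₀ (m n)).integral W (node t n k) ω) (M (node t n k) ω)) atTop (𝓝 0) :=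
      tendsto_of_tendsto_of_tendsto_of_le_of_le tendsto_const_nhds hJ0 (fun _ => zero_le)
        fun n => le_add_self
    have h2 := (ENNReal.tendsto_toReal ENNReal.zero_ne_top).comp h1
    refine h2.congr fun n => ?_
    simp only [Function.comp_apply]
    rw [ENNReal.toReal_sum fun k _ => edist_ne_top _ _, Finset.sum_range]
    refine Finset.sum_congr rfl fun k _ => ?_
    rw [hS2, ← Real.dist_eq, edist_dist, ENNReal.toReal_ofReal dist_nonneg]

/-- The error, on the `k`-th interval of a uniform partition, of freezing the integrand `S` at the
value `v` takes at the left end. -/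
def residual (S : SimpleProcess 𝓕) (W v : ℝ≥0 → Ω → ℝ) (t : ℝ≥0) (n k : ℕ) (ω : Ω) : ℝ :=
  S.integral W (node t n (k + 1)) ω - S.integral W (node t n k) ω
    - v (node t n k) ω * (W (node t n (k + 1)) ω - W (node t n k) ω)

-- Partition blocks overlap at most at endpoints, so a nondegenerate grid interval lies in at most
-- one of them.
open Classical in
lemma blockWeight_mul_self (g : ℕ → ℝ≥0) (t : ℝ≥0) (n l i k : ℕ) :
    blockWeight g (node t n i) (node t n (i + 1)) l * blockWeight g (node t n k) (node t n (k + 1)) l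
      = if i = k then blockWeight g (node t n k) (node t n (k + 1)) l else 0 := by
  split_ifs with hik
  · subst hik
    unfold blockWeight; split_ifs <;> simp
  · wlog hlt : i < k generalizing i k
    · rw [mul_comm]; exact this k i (Ne.symm hik) (by omega)
    by_cases h1 : InBlock g (node t n i) (node t n (i + 1)) l
    · have h2 : ¬ InBlock g (node t n k) (node t n (k + 1)) l := fun h2 =>
        absurd ((h1.2.2.trans (node_mono t n hlt)).trans h2.1) (not_le.2 h1.2.1)
      simp [blockWeight, h2]
    · simp [blockWeight, h1]

/-- The integrand, on the grid of `S`, whose discrete stochastic integral is the sum of the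
residuals weighted by `y`. -/
def residualIntegrand (S : SimpleProcess 𝓕) (v y : ℝ≥0 → Ω → ℝ) (t : ℝ≥0) (n l : ℕ) (ω : Ω) : ℝ :=
  ∑ k ∈ Finset.range (n + 1), blockWeight S.time (node t n k) (node t n (k + 1)) l
    * (y (node t n k) ω * (S.ξ l ω - v (node t n k) ω))

/-- A block that contributes at index `l` starts no later than `S.time l`, so the frozen values are
already known there. -/
lemma residualIntegrand_measurable (S : SimpleProcess 𝓕) {v y : ℝ≥0 → Ω → ℝ}
    (hv : ∀ s, Measurable[𝓕 s] (v s)) (hy : ∀ s, Measurable[𝓕 s] (y s)) (t : ℝ≥0) (n l : ℕ) :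
    Measurable[𝓕 (S.time l)] (residualIntegrand S v y t n l) := by
  refine Finset.measurable_fun_sum _ fun k _ => ?_
  by_cases h : InBlock S.time (node t n k) (node t n (k + 1)) l
  · exact (((hy _).mono (𝓕.mono h.1) le_rfl).mul
      ((S.meas l).sub ((hv _).mono (𝓕.mono h.1) le_rfl))).const_mul _
  · simp only [blockWeight, h, if_false, zero_mul]
    exact measurable_const

lemma blockWeight_mul_residualIntegrand (S : SimpleProcess 𝓕) (v y : ℝ≥0 → Ω → ℝ) (t : ℝ≥0)
    {n k : ℕ} (hk : k ∈ Finset.range (n + 1)) (l : ℕ) (ω : Ω) :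
    blockWeight S.time (node t n k) (node t n (k + 1)) l * residualIntegrand S v y t n l ω
      = blockWeight S.time (node t n k) (node t n (k + 1)) l
        * (y (node t n k) ω * (S.ξ l ω - v (node t n k) ω)) := by
  unfold residualIntegrand
  simp_rw [Finset.mul_sum, ← mul_assoc _ (blockWeight _ _ _ _), blockWeight_mul_self]
  simp only [ite_mul, zero_mul]
  rw [Finset.sum_ite_eq, if_pos hk]

/-- On the refined grid the increment of `W` over the block telescopes, so the frozen term splits
over the same grid intervals as the integral of `S`. -/
lemma sum_blockWeight_mul_residualIntegrand (S : SimpleProcess 𝓕) (W v y : ℝ≥0 → Ω → ℝ) {t : ℝ≥0}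
    {n k : ℕ} (hS : ∀ k ≤ n + 1, OnGrid S.time S.n (node t n k)) (hk : k ∈ Finset.range (n + 1))
    (ω : Ω) :
    ∑ l ∈ Finset.range S.n, blockWeight S.time (node t n k) (node t n (k + 1)) l
      * residualIntegrand S v y t n l ω * (W (S.time (l + 1)) ω - W (S.time l) ω)
      = y (node t n k) ω * residual S W v t n k ω := by
  have hk' : k < n + 1 := Finset.mem_range.1 hk
  unfold residual
  rw [S.integral_sub_integral (hS k hk'.le) (hS (k + 1) hk') (node_mono t n (Nat.le_succ k)) W ω,
    ← sum_blockWeight S.mono (hS k hk'.le) (hS (k + 1) hk') (node_mono t n (Nat.le_succ k))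
      (fun s => W s ω), Finset.mul_sum, ← Finset.sum_sub_distrib, Finset.mul_sum]
  refine Finset.sum_congr rfl fun l _ => ?_
  rw [blockWeight_mul_residualIntegrand S v y t hk]
  ring

lemma sum_residualIntegrand (S : SimpleProcess 𝓕) (W v y : ℝ≥0 → Ω → ℝ) {t : ℝ≥0}
    {n : ℕ} (hS : ∀ k ≤ n + 1, OnGrid S.time S.n (node t n k)) (ω : Ω) :
    ∑ l ∈ Finset.range S.n,
      residualIntegrand S v y t n l ω * (W (S.time (l + 1)) ω - W (S.time l) ω)
      = ∑ k ∈ Finset.range (n + 1), y (node t n k) ω * residual S W v t n k ω := by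
  rw [← Finset.sum_congr rfl fun k hk => sum_blockWeight_mul_residualIntegrand S W v y hS hk ω,
    Finset.sum_comm]
  refine Finset.sum_congr rfl fun l _ => ?_
  rw [← Finset.sum_mul]
  congr 1
  rw [Finset.sum_congr rfl fun k hk => blockWeight_mul_residualIntegrand S v y t hk l ω]
  rfl

/-- On each grid interval `ξ l` is the value of `S`, and `ξ l - v(node)` splits into `S - v(s)` and
`v(s) - v(node)`. The first is measured by the L² error, the second by the oscillation `η`; the
factor 2 is from (a + b)² ≤ 2a² + 2b². -/
lemma energy_residualIntegrand_le (S : SimpleProcess 𝓕) (v y : ℝ≥0 → Ω → ℝ) {t : ℝ≥0}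
    {n : ℕ} {ω : Ω} {K η : ℝ} (hv : Continuous fun s => v s ω)
    (hK : ∀ s ≤ t, |y s ω| ≤ K)
    (hη : ∀ k < n + 1, ∀ s ∈ Set.Icc (node t n k) (node t n (k + 1)),
      |v s ω - v (node t n k) ω| ≤ η) :
    ENNReal.ofReal (∑ l ∈ Finset.range S.n,
      ((S.time (l + 1) : ℝ) - S.time l) * residualIntegrand S v y t n l ω ^ 2)
      ≤ ENNReal.ofReal (2 * K ^ 2) * (∫⁻ s in Set.Icc (0 : ℝ) t,
          ENNReal.ofReal ((S.eval s.toNNReal ω - v s.toNNReal ω) ^ 2))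
        + ENNReal.ofReal (2 * K ^ 2 * η ^ 2 * t) := by
  set F : ℝ → ℝ≥0∞ := fun s => ENNReal.ofReal (2 * K ^ 2)
    * ENNReal.ofReal ((S.eval s.toNNReal ω - v s.toNNReal ω) ^ 2)
    + ENNReal.ofReal (2 * K ^ 2 * η ^ 2) with hF
  have hmeas : Measurable fun s : ℝ =>
      ENNReal.ofReal ((S.eval s.toNNReal ω - v s.toNNReal ω) ^ 2) :=
    (((S.measurable_eval ω).sub (hv.measurable.comp measurable_real_toNNReal)).pow_const
      2).ennreal_ofReal
  have hle : ∀ l, (S.time l : ℝ) ≤ S.time (l + 1) := fun l =>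
    NNReal.coe_le_coe.2 (S.mono (Nat.le_succ l))
  -- The grid of `S` may run past `t`; intervals in no block carry a zero integrand, so cutting at
  -- `t` loses nothing.
  let A : ℕ → Set ℝ := fun l => Set.Ioc (S.time l : ℝ) (S.time (l + 1)) ∩ Set.Icc (0 : ℝ) t
  have hterm : ∀ l ∈ Finset.range S.n, ENNReal.ofReal
      (((S.time (l + 1) : ℝ) - S.time l) * residualIntegrand S v y t n l ω ^ 2)
      ≤ ∫⁻ s in A l, F s := by
    intro l hl
    by_cases hex : ∃ k ∈ Finset.range (n + 1), InBlock S.time (node t n k) (node t n (k + 1)) l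
    · obtain ⟨k, hk, hb⟩ := hex
      have hk' := Finset.mem_range.1 hk
      have h1 := blockWeight_mul_residualIntegrand S v y t hk l ω
      simp only [blockWeight, hb, if_true, one_mul] at h1
      have hA : A l = Set.Ioc (S.time l : ℝ) (S.time (l + 1)) := by
        refine Set.inter_eq_left.2 fun s hs => ⟨(S.time l).2.trans hs.1.le, hs.2.trans ?_⟩
        exact NNReal.coe_le_coe.2 (hb.2.2.trans (node_le hk'))
      rw [hA, h1]
      calc ENNReal.ofReal (((S.time (l + 1) : ℝ) - S.time l)
            * (y (node t n k) ω * (S.ξ l ω - v (node t n k) ω)) ^ 2)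
          = ∫⁻ s in Set.Ioc (S.time l : ℝ) (S.time (l + 1)),
              ENNReal.ofReal ((y (node t n k) ω * (S.ξ l ω - v (node t n k) ω)) ^ 2) := by
            rw [setLIntegral_const, Real.volume_Ioc, mul_comm, ENNReal.ofReal_mul (sq_nonneg _)]
        _ ≤ ∫⁻ s in Set.Ioc (S.time l : ℝ) (S.time (l + 1)), F s := by
            refine setLIntegral_mono' measurableSet_Ioc fun s hs => ?_
            have hs0 : 0 ≤ s := (S.time l).2.trans hs.1.le
            lift s to ℝ≥0 using hs0
            have hs' : s ∈ Set.Ioc (S.time l) (S.time (l + 1)) :=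
              ⟨NNReal.coe_lt_coe.1 hs.1, NNReal.coe_le_coe.1 hs.2⟩
            simp only [hF, Real.toNNReal_coe]
            rw [S.eval_eq (Finset.mem_range.1 hl) hs', ← ENNReal.ofReal_mul (by positivity),
              ← ENNReal.ofReal_add (by positivity) (by positivity)]
            refine ENNReal.ofReal_le_ofReal ?_
            have hy2 : y (node t n k) ω ^ 2 ≤ K ^ 2 :=
              sq_le_sq' (neg_le_of_abs_le (hK _ (node_le hk'.le)))
                (le_of_abs_le (hK _ (node_le hk'.le)))
            have hv2 := hη k hk' s ⟨hb.1.trans hs'.1.le, hs'.2.trans hb.2.2⟩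
            have hv3 : (v s ω - v (node t n k) ω) ^ 2 ≤ η ^ 2 :=
              sq_le_sq' (neg_le_of_abs_le hv2) (le_of_abs_le hv2)
            have h3 : (S.ξ l ω - v (node t n k) ω) ^ 2
                ≤ 2 * (S.ξ l ω - v s ω) ^ 2 + 2 * η ^ 2 := by
              nlinarith [sq_nonneg ((S.ξ l ω - v s ω) - (v s ω - v (node t n k) ω))]
            rw [mul_pow]
            calc _ ≤ K ^ 2 * (2 * (S.ξ l ω - v s ω) ^ 2 + 2 * η ^ 2) :=
                  mul_le_mul hy2 h3 (sq_nonneg _) (sq_nonneg _)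
              _ = _ := by ring
    · have h0 : residualIntegrand S v y t n l ω = 0 := by
        refine Finset.sum_eq_zero fun k hk => ?_
        have : ¬ InBlock S.time (node t n k) (node t n (k + 1)) l := fun hb => hex ⟨k, hk, hb⟩
        simp [blockWeight, this]
      simp [h0]
  have hdisj : Set.PairwiseDisjoint (Finset.range S.n : Set ℕ) A := by
    intro i _ j _ hij
    have hm : Monotone fun l => (S.time l : ℝ) := fun a b h => NNReal.coe_le_coe.2 (S.mono h)
    exact (hm.pairwise_disjoint_on_Ioc_succ hij).mono Set.inter_subset_left Set.inter_subset_left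
  rw [ENNReal.ofReal_sum_of_nonneg fun l _ =>
    mul_nonneg (sub_nonneg.2 (hle l)) (sq_nonneg _)]
  calc _ ≤ ∑ l ∈ Finset.range S.n, ∫⁻ s in A l, F s := Finset.sum_le_sum hterm
    _ = ∫⁻ s in ⋃ l ∈ Finset.range S.n, A l, F s :=
        (lintegral_biUnion_finset hdisj
          (fun l _ => measurableSet_Ioc.inter measurableSet_Icc) F).symm
    _ ≤ ∫⁻ s in Set.Icc (0 : ℝ) t, F s :=
        lintegral_mono_set (Set.iUnion₂_subset fun l _ => Set.inter_subset_right)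
    _ = _ := by
        rw [lintegral_add_right _ measurable_const, lintegral_const_mul _ hmeas, setLIntegral_const,
          Real.volume_Icc, sub_zero, ← ENNReal.ofReal_mul (by positivity)]

lemma tendsto_energy_residualIntegrand {S : ℕ → SimpleProcess 𝓕} {v y : ℝ≥0 → Ω → ℝ} {t : ℝ≥0}
    {ω : Ω} (hv : Continuous fun s => v s ω) (hy : Continuous fun s => y s ω)
    (hS : Tendsto (fun n => ∫⁻ s in Set.Icc (0 : ℝ) t,
      ENNReal.ofReal (((S n).eval s.toNNReal ω - v s.toNNReal ω) ^ 2)) atTop (𝓝 0)) :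
    Tendsto (fun n => ∑ l ∈ Finset.range (S n).n,
      (((S n).time (l + 1) : ℝ) - (S n).time l) * residualIntegrand (S n) v y t n l ω ^ 2)
      atTop (𝓝 0) := by
  obtain ⟨K, hK0, hK⟩ := exists_abs_le hy t
  have hnn : ∀ n, 0 ≤ ∑ l ∈ Finset.range (S n).n,
      (((S n).time (l + 1) : ℝ) - (S n).time l) * residualIntegrand (S n) v y t n l ω ^ 2 :=
    fun n => Finset.sum_nonneg fun l _ => mul_nonneg
      (sub_nonneg.2 (NNReal.coe_le_coe.2 ((S n).mono (Nat.le_succ l)))) (sq_nonneg _)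
  suffices h : Tendsto (fun n => ENNReal.ofReal (∑ l ∈ Finset.range (S n).n,
      (((S n).time (l + 1) : ℝ) - (S n).time l) * residualIntegrand (S n) v y t n l ω ^ 2))
      atTop (𝓝 0) by
    have h2 := (ENNReal.tendsto_toReal ENNReal.zero_ne_top).comp h
    refine h2.congr fun n => ?_
    exact ENNReal.toReal_ofReal (hnn n)
  have h1 : Tendsto (fun n => ENNReal.ofReal (2 * K ^ 2) * ∫⁻ s in Set.Icc (0 : ℝ) t,
      ENNReal.ofReal (((S n).eval s.toNNReal ω - v s.toNNReal ω) ^ 2)) atTop (𝓝 0) := by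
    simpa only [mul_zero] using
      ENNReal.Tendsto.const_mul (a := ENNReal.ofReal (2 * K ^ 2)) hS (Or.inr ENNReal.ofReal_ne_top)
  rw [ENNReal.tendsto_nhds_zero]
  intro ε hε
  have h2 : Tendsto (fun η : ℝ => ENNReal.ofReal (2 * K ^ 2 * η ^ 2 * t)) (𝓝[>] 0) (𝓝 0) := by
    have : Continuous fun η : ℝ => ENNReal.ofReal (2 * K ^ 2 * η ^ 2 * t) :=
      ENNReal.continuous_ofReal.comp (by fun_prop)
    have h3 := this.tendsto 0
    simp only [ne_eq, OfNat.ofNat_ne_zero, not_false_eq_true, zero_pow, mul_zero, zero_mul,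
      ENNReal.ofReal_zero] at h3
    exact h3.mono_left nhdsWithin_le_nhds
  -- The oscillation `η` is fixed first, by the second error term, and only then is `n` taken large.
  obtain ⟨η, hη1, hη⟩ := ((ENNReal.tendsto_nhds_zero.1 h2 (ε / 2) (ENNReal.half_pos hε.ne')).and
    self_mem_nhdsWithin).exists
  filter_upwards [ENNReal.tendsto_nhds_zero.1 h1 (ε / 2) (ENNReal.half_pos hε.ne'),
    eventually_oscillation_le hv t hη] with n hn1 hn2
  calc _ ≤ _ := energy_residualIntegrand_le (S n) v y hv hK hn2
    _ ≤ ε / 2 + ε / 2 := add_le_add hn1 hη1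
    _ = ε := ENNReal.add_halves ε

variable [IsProbabilityMeasure P]

/-- Both quantities come from the same integrand, whose energy vanishes almost surely. The square of
the sum uses the constant weight 1, the sum of squares the block indicators. -/
lemma IsScalarBrownianMotion.tendstoInMeasure_residual (hW : IsScalarBrownianMotion P 𝓕 W)
    {S : ℕ → SimpleProcess 𝓕} {v y : ℝ≥0 → Ω → ℝ} {t : ℝ≥0}
    (hSg : ∀ n, ∀ k ≤ n + 1, OnGrid (S n).time (S n).n (node t n k))
    (hvm : ∀ s, Measurable[𝓕 s] (v s)) (hym : ∀ s, Measurable[𝓕 s] (y s))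
    (hv : ∀ᵐ ω ∂P, Continuous fun s => v s ω) (hy : ∀ᵐ ω ∂P, Continuous fun s => y s ω)
    (hS : ∀ᵐ ω ∂P, Tendsto (fun n => ∫⁻ s in Set.Icc (0 : ℝ) t,
      ENNReal.ofReal (((S n).eval s.toNNReal ω - v s.toNNReal ω) ^ 2)) atTop (𝓝 0)) :
    TendstoInMeasure P (fun n ω =>
      (∑ k ∈ Finset.range (n + 1), y (node t n k) ω * residual (S n) W v t n k ω) ^ 2)
      atTop (fun _ => 0) ∧
    TendstoInMeasure P (fun n ω =>
      ∑ k ∈ Finset.range (n + 1), (y (node t n k) ω * residual (S n) W v t n k ω) ^ 2)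
      atTop (fun _ => 0) := by
  have henergy : ∀ᵐ ω ∂P, Tendsto (fun n => ∑ l ∈ Finset.range (S n).n,
      (((S n).time (l + 1) : ℝ) - (S n).time l) * residualIntegrand (S n) v y t n l ω ^ 2)
      atTop (𝓝 0) := by
    filter_upwards [hv, hy, hS] with ω h1 h2 h3
    exact tendsto_energy_residualIntegrand h1 h2 h3
  have hinc := fun n => hW.isIndepIncrements (S n).mono
  have hm := fun n => residualIntegrand_measurable (S n) hvm hym t n
  constructor
  · have h := IsIndepIncrements.tendstoInMeasure_zero hinc hm (fun _ => (Finset.univ : Finset Unit))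
      (fun _ _ _ => 1) (fun n l => by simp) (fun n => (S n).n) henergy
    refine h.congr_left fun n => Eventually.of_forall fun ω => ?_
    simp only [one_mul, Finset.univ_unique, Finset.sum_singleton]
    rw [sum_residualIntegrand (S n) W v y (hSg n)]
  · have h := IsIndepIncrements.tendstoInMeasure_zero hinc hm (fun n => Finset.range (n + 1))
      (fun n k => blockWeight (S n).time (node t n k) (node t n (k + 1)))
      (fun n l => ?_) (fun n => (S n).n) henergy
    · refine h.congr_left fun n => Eventually.of_forall fun ω => ?_
      refine Finset.sum_congr rfl fun k hk => ?_
      rw [sum_blockWeight_mul_residualIntegrand (S n) W v y (hSg n) hk]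
    · by_cases hex : ∃ k ∈ Finset.range (n + 1),
          InBlock (S n).time (node t n k) (node t n (k + 1)) l
      · obtain ⟨k, hk, hb⟩ := hex
        rw [Finset.sum_eq_single k]
        · simp [blockWeight, hb]
        · intro i _ hik
          have := blockWeight_mul_self (S n).time t n l i k
          rw [if_neg hik] at this
          simp only [blockWeight, hb, if_true, mul_one] at this ⊢
          simp [this]
        · exact fun h => absurd hk h
      · rw [Finset.sum_eq_zero]
        · simp
        · intro k hk
          have : ¬ InBlock (S n).time (node t n k) (node t n (k + 1)) l := fun hb => hex ⟨k, hk, hb⟩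
          simp [blockWeight, this]

/-- The variances of the compensated squares are of order (Δt)², so for a path of `v` bounded on
`[0, t]` the energy is O(1/n). -/
lemma IsScalarBrownianMotion.tendstoInMeasure_sq (hW : IsScalarBrownianMotion P 𝓕 W)
    {v : ℝ≥0 → Ω → ℝ} (t : ℝ≥0) (hvm : ∀ s, Measurable[𝓕 s] (v s))
    (hv : ∀ᵐ ω ∂P, Continuous fun s => v s ω) :
    TendstoInMeasure P (fun n ω => (∑ k ∈ Finset.range (n + 1), v (node t n k) ω ^ 2
        * ((W (node t n (k + 1)) ω - W (node t n k) ω) ^ 2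
          - ((node t n (k + 1) : ℝ) - node t n k))) ^ 2)
      atTop (fun _ => 0) := by
  obtain ⟨K, hK, hinc⟩ := hW.isIndepIncrements_sq
  have h := IsIndepIncrements.tendstoInMeasure_zero (fun n => hinc _ (node_mono t n))
    (ξ := fun n l ω => v (node t n l) ω ^ 2) (fun n l => (hvm _).pow_const 2)
    (fun _ => (Finset.univ : Finset Unit)) (fun _ _ _ => 1) (fun n l => by simp)
    (fun n => n + 1) ?_
  · refine h.congr_left fun n => Eventually.of_forall fun ω => ?_
    simp
  · filter_upwards [hv] with ω hω
    obtain ⟨C, hC0, hC⟩ := exists_abs_le hω t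
    refine squeeze_zero (fun n => Finset.sum_nonneg fun l _ => by positivity) (fun n => ?_)
      (tendsto_mesh (K * t ^ 2 * C ^ 4))
    calc _ ≤ ∑ l ∈ Finset.range (n + 1), K * (t / (n + 1)) ^ 2 * C ^ 4 := by
          refine Finset.sum_le_sum fun l hl => ?_
          rw [node_succ_sub]
          refine mul_le_mul_of_nonneg_left ?_ (by positivity)
          have := hC _ (node_le (Finset.mem_range.1 hl).le)
          calc (v (node t n l) ω ^ 2) ^ 2 = |v (node t n l) ω| ^ 4 := by
                rw [← sq_abs (v (node t n l) ω)]; ring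
            _ ≤ C ^ 4 := by gcongr
      _ = K * t ^ 2 * C ^ 4 / (n + 1) := by
          rw [Finset.sum_const, Finset.card_range, nsmul_eq_mul]
          push_cast
          field_simp

end Residual

/-! ### Pathwise expansion of the square -/

section Pathwise

lemma continuous_comp_toNNReal {f : ℝ≥0 → ℝ} (hf : Continuous f) :
    Continuous fun s : ℝ => f s.toNNReal := hf.comp continuous_real_toNNReal

lemma setIntegral_Icc_eq_intervalIntegral (f : ℝ → ℝ) (r : ℝ≥0) :
    ∫ s in Set.Icc (0 : ℝ) r, f s = ∫ s in (0 : ℝ)..r, f s := by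
  rw [intervalIntegral.integral_of_le (NNReal.coe_nonneg r), integral_Icc_eq_integral_Ioc]

/-- Riemann–Stieltjes sums of continuous functions. -/
lemma tendsto_riemann_sum {f g : ℝ≥0 → ℝ} (hf : Continuous f) (hg : Continuous g) (t : ℝ≥0) :
    Tendsto (fun n => ∑ k ∈ Finset.range (n + 1), f (node t n k)
        * ∫ s in (node t n k : ℝ)..node t n (k + 1), g s.toNNReal) atTop
      (𝓝 (∫ s in (0 : ℝ)..t, f s.toNNReal * g s.toNNReal)) := by
  obtain ⟨K, hK0, hK⟩ := exists_abs_le hg t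
  have hf' := continuous_comp_toNNReal hf
  have hg' := continuous_comp_toNNReal hg
  have hfg : ∀ a b, IntervalIntegrable (fun s : ℝ => f s.toNNReal * g s.toNNReal) volume a b :=
    fun a b => (hf'.mul hg').intervalIntegrable a b
  have hcg : ∀ c a b, IntervalIntegrable (fun s : ℝ => c * g s.toNNReal) volume a b :=
    fun c a b => (continuous_const.mul hg').intervalIntegrable a b
  rw [Metric.tendsto_atTop']
  intro ε hε
  obtain ⟨η, hη, hηε⟩ : ∃ η : ℝ, 0 < η ∧ η * K * t < ε := by
    -- The summand 1 covers the case `K * t = 0`.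
    refine ⟨ε / (2 * (K * t + 1)), by positivity, ?_⟩
    rw [mul_assoc, div_mul_eq_mul_div, div_lt_iff₀ (by positivity)]
    have : 0 ≤ K * t := by positivity
    nlinarith
  obtain ⟨n₀, hn₀⟩ := eventually_atTop.1 (eventually_oscillation_le hf t hη)
  refine ⟨n₀, fun n hn => ?_⟩
  have hosc := hn₀ n hn.le
  rw [Real.dist_eq]
  have h1 : ∫ s in (0 : ℝ)..t, f s.toNNReal * g s.toNNReal = ∑ k ∈ Finset.range (n + 1),
      ∫ s in (node t n k : ℝ)..node t n (k + 1), f s.toNNReal * g s.toNNReal := by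
    rw [intervalIntegral.sum_integral_adjacent_intervals (a := fun k => (node t n k : ℝ))
      fun k _ => hfg _ _]
    simp
  rw [h1, ← Finset.sum_sub_distrib]
  refine lt_of_le_of_lt ((Finset.abs_sum_le_sum_abs _ _).trans
    (Finset.sum_le_sum (g := fun _ => η * K * (t / (n + 1))) fun k hk => ?_)) ?_
  · have hk' := Finset.mem_range.1 hk
    rw [← intervalIntegral.integral_const_mul, ← intervalIntegral.integral_sub
      (hcg _ _ _) (hfg _ _)]
    have hle : (node t n k : ℝ) ≤ node t n (k + 1) :=
      NNReal.coe_le_coe.2 (node_mono t n (Nat.le_succ k))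
    have h2 := intervalIntegral.norm_integral_le_of_norm_le_const
      (a := (node t n k : ℝ)) (b := node t n (k + 1)) (C := η * K)
      (f := fun s => f (node t n k) * g s.toNNReal - f s.toNNReal * g s.toNNReal) (fun s hs => ?_)
    · rw [node_succ_sub, abs_of_nonneg (by positivity)] at h2
      exact h2
    · rw [Set.uIoc_of_le hle] at hs
      have hs0 : 0 ≤ s := (node t n k).2.trans hs.1.le
      lift s to ℝ≥0 using hs0
      have hs1 : s ≤ node t n (k + 1) := NNReal.coe_le_coe.1 hs.2
      rw [Real.toNNReal_coe, ← sub_mul, norm_mul, Real.norm_eq_abs, Real.norm_eq_abs, abs_sub_comm]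
      exact mul_le_mul (hosc k hk' s ⟨NNReal.coe_le_coe.1 hs.1.le, hs1⟩)
        (hK s (hs1.trans (node_le hk'))) (abs_nonneg _) hη.le
  · refine lt_of_eq_of_lt ?_ hηε
    rw [Finset.sum_const, Finset.card_range, nsmul_eq_mul]
    push_cast
    field_simp

lemma tendsto_riemann_sum_one {f : ℝ≥0 → ℝ} (hf : Continuous f) (t : ℝ≥0) :
    Tendsto (fun n => ∑ k ∈ Finset.range (n + 1), f (node t n k)
        * ((node t n (k + 1) : ℝ) - node t n k)) atTop (𝓝 (∫ s in (0 : ℝ)..t, f s.toNNReal)) := by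
  have h := tendsto_riemann_sum hf (continuous_const (y := (1 : ℝ))) t
  simpa using h

/-- Each drift increment is O(1/n) and there are `n + 1` of them: the drift has no quadratic
variation. -/
lemma tendsto_sum_sq_integral {u : ℝ≥0 → ℝ} (hu : Continuous u) (t : ℝ≥0) :
    Tendsto (fun n => ∑ k ∈ Finset.range (n + 1),
      (∫ s in (node t n k : ℝ)..node t n (k + 1), u s.toNNReal) ^ 2) atTop (𝓝 0) := by
  obtain ⟨K, hK0, hK⟩ := exists_abs_le hu t
  refine squeeze_zero (fun n => Finset.sum_nonneg fun k _ => sq_nonneg _) (fun n => ?_)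
    (tendsto_mesh (K ^ 2 * t ^ 2))
  calc _ ≤ ∑ _k ∈ Finset.range (n + 1), (K * (t / (n + 1))) ^ 2 := by
        refine Finset.sum_le_sum fun k hk => ?_
        have hle : (node t n k : ℝ) ≤ node t n (k + 1) :=
          NNReal.coe_le_coe.2 (node_mono t n (Nat.le_succ k))
        have h2 := intervalIntegral.norm_integral_le_of_norm_le_const
          (a := (node t n k : ℝ)) (b := node t n (k + 1)) (C := K)
          (f := fun s => u s.toNNReal) (fun s hs => ?_)
        · rw [node_succ_sub, abs_of_nonneg (by positivity)] at h2
          exact sq_le_sq' (neg_le_of_abs_le h2) (le_of_abs_le h2)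
        · rw [Set.uIoc_of_le hle] at hs
          have hs0 : 0 ≤ s := (node t n k).2.trans hs.1.le
          lift s to ℝ≥0 using hs0
          have hs1 : s ≤ node t n (k + 1) := NNReal.coe_le_coe.1 hs.2
          rw [Real.toNNReal_coe]
          exact hK s (hs1.trans (node_le (Finset.mem_range.1 hk)))
    _ = K ^ 2 * t ^ 2 / (n + 1) := by
        rw [Finset.sum_const, Finset.card_range, nsmul_eq_mul]
        push_cast
        field_simp

/-- The deterministic part of Itô's formula for the square: the path `x` has increments
`∫ u + (m increment)`, and the increments of `m` are close to those of `v dw`, up to `A` and small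
corrections. -/
lemma tendsto_sq_sub_sum {t : ℝ≥0} {x u v m w : ℝ≥0 → ℝ} (hx : Continuous x) (hu : Continuous u)
    (hv : Continuous v) {A : ℕ → ℕ → ℝ} {F : Filter ℕ} (hF : F ≤ atTop)
    (hdec : ∀ n, ∀ k ≤ n + 1, x (node t n k)
      = x 0 + (∫ s in Set.Icc (0 : ℝ) (node t n k), u s.toNNReal) + m (node t n k))
    (hA : Tendsto (fun n => ∑ k ∈ Finset.range (n + 1), |m (node t n (k + 1)) - m (node t n k)
      - v (node t n k) * (w (node t n (k + 1)) - w (node t n k)) - A n k|) F (𝓝 0))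
    (hxA : Tendsto (fun n => ∑ k ∈ Finset.range (n + 1), x (node t n k) * A n k) F (𝓝 0))
    (hAA : Tendsto (fun n => ∑ k ∈ Finset.range (n + 1), A n k ^ 2) F (𝓝 0))
    (hw : Tendsto (fun n => ∑ k ∈ Finset.range (n + 1), v (node t n k) ^ 2
      * ((w (node t n (k + 1)) - w (node t n k)) ^ 2 - ((node t n (k + 1) : ℝ) - node t n k)))
      F (𝓝 0)) :
    Tendsto (fun n => x t ^ 2 - x 0 ^ 2 - ∑ k ∈ Finset.range (n + 1),
        2 * (x (node t n k) * v (node t n k)) * (w (node t n (k + 1)) - w (node t n k))) F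
      (𝓝 (∫ s in Set.Icc (0 : ℝ) t,
        (2 * (x s.toNNReal * u s.toNNReal) + v s.toNNReal ^ 2))) := by
  have hx' := continuous_comp_toNNReal hx
  have hu' := continuous_comp_toNNReal hu
  have hv' := continuous_comp_toNNReal hv
  -- An increment of `x` is the leading term `V` plus an error `E`, made of the drift `D`, the
  -- freezing residual `A` and the approximation error `R`. Since `F` is only required to refine
  -- `atTop`, the computation also applies along a subsequence.
  let V : ℕ → ℕ → ℝ := fun n k => v (node t n k) * (w (node t n (k + 1)) - w (node t n k))
  let D : ℕ → ℕ → ℝ := fun n k => ∫ s in (node t n k : ℝ)..node t n (k + 1), u s.toNNReal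
  let R : ℕ → ℕ → ℝ := fun n k => m (node t n (k + 1)) - m (node t n k) - V n k - A n k
  let E : ℕ → ℕ → ℝ := fun n k => D n k + A n k + R n k
  have hA' : Tendsto (fun n => ∑ k ∈ Finset.range (n + 1), |R n k|) F (𝓝 0) := hA
  have hIcc := setIntegral_Icc_eq_intervalIntegral
  have hinc : ∀ n, ∀ k ∈ Finset.range (n + 1),
      x (node t n (k + 1)) - x (node t n k) = V n k + E n k := fun n k hk => by
    have hk' := Finset.mem_range.1 hk
    have h1 : D n k = (∫ s in (0 : ℝ)..node t n (k + 1), u s.toNNReal)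
        - ∫ s in (0 : ℝ)..node t n k, u s.toNNReal :=
      (intervalIntegral.integral_interval_sub_left (hu'.intervalIntegrable _ _)
        (hu'.intervalIntegrable _ _)).symm
    rw [hdec n k hk'.le, hdec n (k + 1) hk', hIcc, hIcc]
    simp only [E, R]
    rw [h1]; ring
  have htel : ∀ n, x t ^ 2 - x 0 ^ 2 = ∑ k ∈ Finset.range (n + 1),
      (2 * x (node t n k) * (V n k + E n k) + (V n k + E n k) ^ 2) := fun n => by
    have := Finset.sum_range_sub (fun k => x (node t n k) ^ 2) (n + 1)
    simp only [node_last, node_zero] at this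
    rw [← this]
    refine Finset.sum_congr rfl fun k hk => ?_
    rw [← hinc n k hk]; ring
  obtain ⟨K, hK0, hK⟩ := exists_abs_le hx t
  -- `R` is small in ℓ¹, so boundedness of `x` suffices. `A` is not known to be, which is why its
  -- sum against `x` is a separate hypothesis.
  have hxR : Tendsto (fun n => ∑ k ∈ Finset.range (n + 1), x (node t n k) * R n k) F (𝓝 0) := by
    have h0 : Tendsto (fun n => K * ∑ k ∈ Finset.range (n + 1), |R n k|) F (𝓝 0) := by
      simpa using hA'.const_mul K
    refine squeeze_zero_norm (fun n => ?_) h0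
    rw [Finset.mul_sum]
    refine (Finset.abs_sum_le_sum_abs _ _).trans (Finset.sum_le_sum fun k hk => ?_)
    rw [abs_mul]
    exact mul_le_mul_of_nonneg_right (hK _ (node_le (Finset.mem_range.1 hk).le)) (abs_nonneg _)
  have hxD : Tendsto (fun n => ∑ k ∈ Finset.range (n + 1), x (node t n k) * D n k) F
      (𝓝 (∫ s in (0 : ℝ)..t, x s.toNNReal * u s.toNNReal)) :=
    (tendsto_riemann_sum hx hu t).mono_left hF
  have hRR : Tendsto (fun n => ∑ k ∈ Finset.range (n + 1), R n k ^ 2) F (𝓝 0) := by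
    have h0 : Tendsto (fun n => (∑ k ∈ Finset.range (n + 1), |R n k|) ^ 2) F (𝓝 0) := by
      simpa using hA'.pow 2
    refine squeeze_zero (fun n => Finset.sum_nonneg fun k _ => sq_nonneg _) (fun n => ?_) h0
    simp_rw [← sq_abs (R n _)]
    exact Finset.sum_sq_le_sq_sum_of_nonneg fun k _ => abs_nonneg _
  have hDD : Tendsto (fun n => ∑ k ∈ Finset.range (n + 1), D n k ^ 2) F (𝓝 0) :=
    (tendsto_sum_sq_integral hu t).mono_left hF
  have hEE : Tendsto (fun n => ∑ k ∈ Finset.range (n + 1), E n k ^ 2) F (𝓝 0) := by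
    have h0 := ((hDD.add hAA).add hRR).const_mul 3
    simp only [add_zero, mul_zero] at h0
    refine squeeze_zero (fun n => Finset.sum_nonneg fun k _ => sq_nonneg _) (fun n => ?_) h0
    rw [← Finset.sum_add_distrib, ← Finset.sum_add_distrib, Finset.mul_sum]
    refine Finset.sum_le_sum fun k _ => ?_
    simp only [E]
    nlinarith [sq_nonneg (D n k - A n k), sq_nonneg (D n k - R n k), sq_nonneg (A n k - R n k)]
  have hVV : Tendsto (fun n => ∑ k ∈ Finset.range (n + 1), V n k ^ 2) F
      (𝓝 (∫ s in (0 : ℝ)..t, v s.toNNReal ^ 2)) := by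
    have h0 := hw.add ((tendsto_riemann_sum_one (hv.pow 2) t).mono_left hF)
    rw [zero_add] at h0
    refine h0.congr fun n => ?_
    rw [← Finset.sum_add_distrib]
    refine Finset.sum_congr rfl fun k _ => ?_
    simp only [V, Pi.pow_apply]
    ring
  -- Cauchy–Schwarz: the squares of `V` have a finite limit sum and those of `E` tend to zero.
  have hVE : Tendsto (fun n => ∑ k ∈ Finset.range (n + 1), V n k * E n k) F (𝓝 0) := by
    have h0 := (hVV.mul hEE).sqrt
    rw [mul_zero, Real.sqrt_zero] at h0
    refine squeeze_zero_norm (fun n => ?_) h0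
    exact Real.abs_le_sqrt (Finset.sum_mul_sq_le_sq_mul_sq _ _ _)
  have htotal := (((((hxD.add hxA).add hxR).const_mul 2).add hVV).add (hVE.const_mul 2)).add hEE
  have hlim : 2 * ((∫ s in (0 : ℝ)..t, x s.toNNReal * u s.toNNReal) + 0 + 0)
      + (∫ s in (0 : ℝ)..t, v s.toNNReal ^ 2) + 2 * 0 + 0
      = ∫ s in Set.Icc (0 : ℝ) t, (2 * (x s.toNNReal * u s.toNNReal) + v s.toNNReal ^ 2) := by
    have h1 : IntervalIntegrable (fun s : ℝ => 2 * (x s.toNNReal * u s.toNNReal)) volume 0 t :=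
      (continuous_const.mul (hx'.mul hu')).intervalIntegrable _ _
    have h2 : IntervalIntegrable (fun s : ℝ => v s.toNNReal ^ 2) volume 0 t :=
      (hv'.pow 2).intervalIntegrable _ _
    rw [hIcc, intervalIntegral.integral_add h1 h2, intervalIntegral.integral_const_mul]
    ring
  rw [hlim] at htotal
  refine htotal.congr fun n => ?_
  rw [htel n, ← Finset.sum_sub_distrib, ← Finset.sum_add_distrib, ← Finset.sum_add_distrib,
    Finset.mul_sum, Finset.mul_sum, ← Finset.sum_add_distrib, ← Finset.sum_add_distrib,
    ← Finset.sum_add_distrib]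
  refine Finset.sum_congr rfl fun k _ => ?_
  simp only [E, V]
  ring

end Pathwise

/-! ### Uniqueness of the integral, Itô's formula for squares, the Bessel equation -/

section Ito

variable {Ω : Type*} [mΩ : MeasurableSpace Ω] {P : Measure Ω} {𝓕 : Filtration ℝ≥0 mΩ}
  {W : ℝ≥0 → Ω → ℝ}

/-- Extract an almost surely convergent subsequence of the sum of the absolute values; it dominates
every member. -/
lemma exists_common_subseq {I : Type*} [Fintype I] {f : I → ℕ → Ω → ℝ}
    (h : ∀ i, TendstoInMeasure P (f i) atTop fun _ => 0) :
    ∃ ns : ℕ → ℕ, StrictMono ns ∧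
      ∀ᵐ ω ∂P, ∀ i, Tendsto (fun j => f i (ns j) ω) atTop (𝓝 0) := by
  have hsum : TendstoInMeasure P (fun n ω => ∑ i, |f i n ω|) atTop fun _ => 0 := by
    intro ε hε
    have h0 := tendsto_measure_le_sum (P := P) (C := fun _ : I => 1)
      (J := fun i n ω => edist (f i n ω) 0) (fun _ => by simp) (fun i ε hε => h i ε hε) hε
    refine tendsto_of_tendsto_of_tendsto_of_le_of_le tendsto_const_nhds h0 (fun _ => zero_le) ?_
    intro n
    refine measure_mono fun ω hω => le_trans (α := ℝ≥0∞) hω ?_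
    simp only [edist_zero_right, one_mul]
    refine (enorm_sum_le _ _).trans (Finset.sum_le_sum fun i _ => ?_)
    simp
  obtain ⟨ns, hns, hae⟩ := hsum.exists_seq_tendsto_ae
  refine ⟨ns, hns, ?_⟩
  filter_upwards [hae] with ω hω i
  refine squeeze_zero_norm (fun j => ?_) hω
  exact Finset.single_le_sum (f := fun i => |f i (ns j) ω|) (fun i _ => abs_nonneg _)
    (Finset.mem_univ i)

lemma isItoIntegral_zero : IsItoIntegral P 𝓕 W (fun _ _ => 0) fun _ _ => 0 := by
  refine ⟨fun _ => ⟨0, fun _ => 0, monotone_const, fun _ _ => 0, fun _ => measurable_const,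
    fun _ => ⟨0, by simp⟩⟩, fun t => ⟨fun ε hε => ?_, fun ε hε => ?_⟩⟩
  · simp [SimpleProcess.eval, hε.ne']
  · simp [SimpleProcess.integral, hε.ne']

lemma isItoIntegral_one :
    IsItoIntegral P 𝓕 W (fun _ _ => 1) fun t ω => W t ω - W 0 ω := by
  refine ⟨fun m => ⟨1, fun k => k * m, fun a b h => by dsimp only; gcongr, fun _ _ => 1,
    fun _ => measurable_const, fun _ => ⟨1, by simp⟩⟩, fun t => ?_⟩
  have hev : ∀ᶠ m : ℕ in atTop, t ≤ m := tendsto_natCast_atTop_atTop.eventually_ge_atTop t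
  constructor
  · intro ε hε
    refine tendsto_const_nhds.congr' ?_
    filter_upwards [hev] with m hm
    have h0 : ∀ ω : Ω, ∫⁻ s in Set.Icc (0 : ℝ) t, ENNReal.ofReal (((⟨1, fun k => k * m,
        fun a b h => by dsimp only; gcongr, fun _ _ => 1, fun _ => measurable_const,
        fun _ => ⟨1, by simp⟩⟩ : SimpleProcess 𝓕).eval s.toNNReal ω - 1) ^ 2) = 0 := fun ω => by
      -- The simple process on `(0, m]` misses only time 0, a null set.
      rw [setLIntegral_congr Ioc_ae_eq_Icc.symm, setLIntegral_congr_fun measurableSet_Ioc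
        (g := fun _ => 0), lintegral_zero]
      intro s hs
      have h1 : 0 < s.toNNReal := Real.toNNReal_pos.2 hs.1
      have h2 : s.toNNReal ≤ m := (Real.toNNReal_le_iff_le_coe.2 hs.2).trans hm
      simp [SimpleProcess.eval, hs.1, h2]
    simp only [h0]
    simp [hε.ne']
  · intro ε hε
    refine tendsto_const_nhds.congr' ?_
    filter_upwards [hev] with m hm
    simp [SimpleProcess.integral, min_eq_left hm, hε.ne']

variable [IsProbabilityMeasure P]

/-- Freezing at the value 0, the residuals telescope to the simple integrals up to `t`. These tend
to zero along a subsequence almost surely, and also to `M t`. -/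
lemma IsItoIntegral.ae_eq_zero (hW : IsScalarBrownianMotion P 𝓕 W) {M : ℝ≥0 → Ω → ℝ}
    (h : IsItoIntegral P 𝓕 W (fun _ _ => 0) M) (t : ℝ≥0) : ∀ᵐ ω ∂P, M t ω = 0 := by
  obtain ⟨S, hSg, hS⟩ := h.exists_approx t
  have hres := (hW.tendstoInMeasure_residual (v := fun _ _ => 0) (y := fun _ _ => 1) hSg
    (fun _ => measurable_const) (fun _ => measurable_const)
    (Eventually.of_forall fun _ => continuous_const)
    (Eventually.of_forall fun _ => continuous_const) (hS.mono fun ω hω => hω.1)).1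
  obtain ⟨ns, hns, hae⟩ := hres.exists_seq_tendsto_ae
  filter_upwards [hae, hS] with ω h1 h2
  have h3 : Tendsto (fun j => (S (ns j)).integral W t ω ^ 2) atTop (𝓝 0) := by
    refine h1.congr fun j => ?_
    have := Finset.sum_range_sub (fun k => (S (ns j)).integral W (node t (ns j) k) ω) (ns j + 1)
    simp only [node_last, node_zero, SimpleProcess.integral_zero, sub_zero] at this
    simp only [residual, zero_mul, sub_zero, one_mul, this]
  have h4 : Tendsto (fun j => (S (ns j)).integral W t ω - M t ω) atTop (𝓝 0) := by
    refine squeeze_zero_norm (fun j => ?_) (h2.2.comp hns.tendsto_atTop)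
    have := Finset.single_le_sum
      (f := fun k => |(S (ns j)).integral W (node t (ns j) k) ω - M (node t (ns j) k) ω|)
      (fun k _ => abs_nonneg _) (Finset.self_mem_range_succ (ns j + 1))
    simp only [node_last] at this
    exact this
  have h5 : Tendsto (fun j => (S (ns j)).integral W t ω ^ 2) atTop (𝓝 (M t ω ^ 2)) := by
    have := (h4.add_const (M t ω)).pow 2
    simpa using this
  exact pow_eq_zero_iff two_ne_zero |>.1 (tendsto_nhds_unique h5 h3)

/-- Uniqueness of the Itô integral. -/
lemma IsItoIntegral.ae_eq (hW : IsScalarBrownianMotion P 𝓕 W) {H M M' : ℝ≥0 → Ω → ℝ}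
    (h : IsItoIntegral P 𝓕 W H M) (h' : IsItoIntegral P 𝓕 W H M')
    (hH : ∀ᵐ ω ∂P, Continuous fun t => H t ω) (t : ℝ≥0) : ∀ᵐ ω ∂P, M t ω = M' t ω := by
  have hc := IsItoIntegral.linearCombination (I := Bool) (H := fun _ => H)
    (M := fun b => if b then M else M') (fun b => by cases b <;> assumption) (fun _ => hH)
    (fun b => if b then 1 else -1)
  have h0 : (fun (t : ℝ≥0) (ω : Ω) => ∑ b : Bool, (if b then (1 : ℝ) else -1) * H t ω)
      = fun _ _ => 0 := by
    ext t ω; simp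
  rw [h0] at hc
  filter_upwards [hc.ae_eq_zero hW t] with ω hω
  simp only [Fintype.sum_bool, if_true, Bool.false_eq_true, if_false] at hω
  linarith

/-- Itô's formula for the squares of finitely many Itô processes: along a common sequence of
uniform partitions, the Riemann sums of the stochastic integrals `∫ 2 X v dW` converge. -/
lemma exists_seq_tendsto_sq_sub_sum {I : Type*} [Fintype I] (hW : IsScalarBrownianMotion P 𝓕 W)
    {X u v M : I → ℝ≥0 → Ω → ℝ} (hXm : ∀ i t, Measurable[𝓕 t] (X i t))
    (hvm : ∀ i t, Measurable[𝓕 t] (v i t)) (hX : ∀ᵐ ω ∂P, ∀ i, Continuous fun t => X i t ω)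
    (hu : ∀ᵐ ω ∂P, ∀ i, Continuous fun t => u i t ω)
    (hv : ∀ᵐ ω ∂P, ∀ i, Continuous fun t => v i t ω)
    (hM : ∀ i, IsItoIntegral P 𝓕 W (v i) (M i))
    (heq : ∀ t : ℝ≥0, ∀ᵐ ω ∂P, ∀ i,
      X i t ω = X i 0 ω + (∫ s in Set.Icc (0 : ℝ) t, u i s.toNNReal ω) + M i t ω) (t : ℝ≥0) :
    ∃ ns : ℕ → ℕ, StrictMono ns ∧ ∀ᵐ ω ∂P, ∀ i,
      Tendsto (fun j => X i t ω ^ 2 - X i 0 ω ^ 2 - ∑ k ∈ Finset.range (ns j + 1),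
        2 * (X i (node t (ns j) k) ω * v i (node t (ns j) k) ω)
          * (W (node t (ns j) (k + 1)) ω - W (node t (ns j) k) ω)) atTop
        (𝓝 (∫ s in Set.Icc (0 : ℝ) t,
          (2 * (X i s.toNNReal ω * u i s.toNNReal ω) + v i s.toNNReal ω ^ 2))) := by
  choose S hSg hS using fun i => (hM i).exists_approx t
  have hX' := fun i => hX.mono fun ω hω => hω i
  have hv' := fun i => hv.mono fun ω hω => hω i
  have hS1 := fun i => (hS i).mono fun ω hω => hω.1
  -- All particles and all three error types share one subsequence, so that the sums over particles
  -- can later be taken on the same partitions.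
  obtain ⟨ns, hns, hae⟩ := exists_common_subseq (P := P) (I := I ⊕ (I ⊕ I))
    (f := Sum.elim
      (fun i n ω => (∑ k ∈ Finset.range (n + 1),
        X i (node t n k) ω * residual (S i n) W (v i) t n k ω) ^ 2)
      (Sum.elim
        (fun i n ω => ∑ k ∈ Finset.range (n + 1),
          ((1 : ℝ) * residual (S i n) W (v i) t n k ω) ^ 2)
        (fun i n ω => (∑ k ∈ Finset.range (n + 1), v i (node t n k) ω ^ 2
          * ((W (node t n (k + 1)) ω - W (node t n k) ω) ^ 2
            - ((node t n (k + 1) : ℝ) - node t n k))) ^ 2))) (fun i => by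
    rcases i with i | i | i
    · exact (hW.tendstoInMeasure_residual (hSg i) (hvm i) (hXm i) (hv' i) (hX' i) (hS1 i)).1
    · exact (hW.tendstoInMeasure_residual (y := fun _ _ => 1) (hSg i) (hvm i)
        (fun _ => measurable_const) (hv' i)
        (Eventually.of_forall fun _ => continuous_const) (hS1 i)).2
    · exact hW.tendstoInMeasure_sq t (hvm i) (hv' i))
  refine ⟨ns, hns, ?_⟩
  have heq' : ∀ᵐ ω ∂P, ∀ n k : ℕ, ∀ i, X i (node t n k) ω = X i 0 ω
      + (∫ s in Set.Icc (0 : ℝ) (node t n k), u i s.toNNReal ω) + M i (node t n k) ω :=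
    ae_all_iff.2 fun n => ae_all_iff.2 fun k => heq (node t n k)
  have sq_lim : ∀ {f : ℕ → ℝ}, Tendsto (fun j => f j ^ 2) atTop (𝓝 0) →
      Tendsto f atTop (𝓝 0) := fun {f} h => by
    have := h.sqrt
    simp only [Real.sqrt_sq_eq_abs, Real.sqrt_zero] at this
    exact (tendsto_zero_iff_abs_tendsto_zero f).2 this
  filter_upwards [hae, hX, hu, hv, heq', ae_all_iff.2 hS] with ω hae hX hu hv heq hS i
  refine tendsto_map'_iff.1 (tendsto_sq_sub_sum (x := fun s => X i s ω) (u := fun s => u i s ω)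
    (v := fun s => v i s ω) (m := fun s => M i s ω) (w := fun s => W s ω)
    (A := fun n k => residual (S i n) W (v i) t n k ω) (F := map ns atTop) (hX i) (hu i) (hv i)
    hns.tendsto_atTop (fun n k _ => heq n k i) ?_ ?_ ?_ ?_)
  · have h0 := ((hS i).2.comp hns.tendsto_atTop).const_mul 2
    rw [mul_zero] at h0
    refine tendsto_map'_iff.2 (squeeze_zero (fun j => Finset.sum_nonneg fun k _ => abs_nonneg _)
      (fun j => ?_) h0)
    set n := ns j
    set e : ℕ → ℝ := fun k => |(S i n).integral W (node t n k) ω - M i (node t n k) ω|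
    -- Each node error counts at most twice, as the end of one interval and as the start of the
    -- next.
    calc _ ≤ ∑ k ∈ Finset.range (n + 1), (e (k + 1) + e k) := by
          refine Finset.sum_le_sum fun k _ => ?_
          simp only [residual, e]
          rw [abs_sub_comm]
          refine le_trans (le_of_eq ?_) (abs_sub _ _)
          congr 1
          ring
      _ ≤ ∑ k ∈ Finset.range (n + 2), e k + ∑ k ∈ Finset.range (n + 2), e k := by
          rw [Finset.sum_add_distrib]
          refine add_le_add ?_ ?_
          · rw [Finset.sum_range_succ' e (n + 1)]
            exact le_add_of_nonneg_right (abs_nonneg _)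
          · rw [Finset.sum_range_succ e (n + 1)]
            exact le_add_of_nonneg_right (abs_nonneg _)
      _ = _ := (two_mul _).symm
  · exact tendsto_map'_iff.2 (sq_lim (hae (Sum.inl i)))
  · have := hae (Sum.inr (Sum.inl i))
    simp only [Sum.elim_inr, Sum.elim_inl, one_mul] at this
    exact tendsto_map'_iff.2 this
  · exact tendsto_map'_iff.2 (sq_lim (hae (Sum.inr (Sum.inr i))))

/-- If `dX_i = (δ - 3/2) X_i / (4 V²) dt + X_i / (2 V) dW`, where `V > 0` is the mean of the
squares `X_i²`, then `V` is a `δ`-Bessel process driven by `W`. -/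
theorem bessel_of_mean_sq {N : ℕ} [NeZero N] (hW : IsScalarBrownianMotion P 𝓕 W) (δ : ℝ)
    {X M : Fin N → ℝ≥0 → Ω → ℝ} {V : ℝ≥0 → Ω → ℝ} (hVX : ∀ t ω, V t ω = (∑ i, X i t ω ^ 2) / N)
    (hXm : ∀ i t, Measurable[𝓕 t] (X i t)) (hX : ∀ᵐ ω ∂P, ∀ i, Continuous fun t => X i t ω)
    (hV : ∀ᵐ ω ∂P, ∀ t, 0 < V t ω)
    (hM : ∀ i, IsItoIntegral P 𝓕 W (fun t ω => X i t ω / (2 * V t ω)) (M i))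
    (heq : ∀ t : ℝ≥0, ∀ᵐ ω ∂P, ∀ i, X i t ω = X i 0 ω + (∫ s in Set.Icc (0 : ℝ) t,
      (δ - 3 / 2) * (X i s.toNNReal ω / (4 * V s.toNNReal ω ^ 2))) + M i t ω) (t : ℝ≥0) :
    ∀ᵐ ω ∂P, V t ω = V 0 ω + (∫ s in Set.Icc (0 : ℝ) t, (δ - 1) / (2 * V s.toNNReal ω))
      + (W t ω - W 0 ω) := by
  have hN : (N : ℝ) ≠ 0 := Nat.cast_ne_zero.2 (NeZero.ne N)
  have hVm : ∀ t, Measurable[𝓕 t] (V t) := fun t => by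
    rw [show V t = fun ω => (∑ i, X i t ω ^ 2) / N from funext (hVX t)]
    exact (Finset.measurable_fun_sum _ fun i _ => (hXm i t).pow_const 2).div_const _
  have hVc : ∀ᵐ ω ∂P, Continuous fun t => V t ω := by
    filter_upwards [hX] with ω hω
    simp_rw [hVX]
    exact (continuous_finsetSum _ fun i _ => (hω i).pow 2).div_const _
  have hu : ∀ᵐ ω ∂P, ∀ i, Continuous fun t => (δ - 3 / 2) * (X i t ω / (4 * V t ω ^ 2)) := by
    filter_upwards [hX, hVc, hV] with ω h1 h2 h3 i
    exact continuous_const.mul ((h1 i).div₀ (continuous_const.mul (h2.pow 2)) fun t =>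
      (mul_pos four_pos (pow_pos (h3 t) 2)).ne')
  have hv : ∀ᵐ ω ∂P, ∀ i, Continuous fun t => X i t ω / (2 * V t ω) := by
    filter_upwards [hX, hVc, hV] with ω h1 h2 h3 i
    exact (h1 i).div₀ (continuous_const.mul h2) fun t => (mul_pos two_pos (h3 t)).ne'
  obtain ⟨ns, -, hae⟩ := exists_seq_tendsto_sq_sub_sum hW
    (u := fun i t ω => (δ - 3 / 2) * (X i t ω / (4 * V t ω ^ 2)))
    (v := fun i t ω => X i t ω / (2 * V t ω)) hXm
    (fun i t => (hXm i t).div ((hVm t).const_mul 2)) hX hu hv hM heq t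
  filter_upwards [hae, hX, hu, hv, hV] with ω hae hX hu hv hV
  have hsq : ∀ t, ∑ i, X i t ω ^ 2 = N * V t ω := fun t => by rw [hVX]; field_simp
  have hlim := tendsto_finsetSum (Finset.univ : Finset (Fin N)) fun i _ => hae i
  -- Summed over `i`, the integrand 2 X_i v_i = X_i² / V is exactly `N` at every node, so the
  -- Riemann sum telescopes and does not depend on the partition.
  have hconst : ∀ j, ∑ i, (X i t ω ^ 2 - X i 0 ω ^ 2 - ∑ k ∈ Finset.range (ns j + 1),
        2 * (X i (node t (ns j) k) ω * (X i (node t (ns j) k) ω / (2 * V (node t (ns j) k) ω)))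
          * (W (node t (ns j) (k + 1)) ω - W (node t (ns j) k) ω))
      = N * (V t ω - V 0 ω - (W t ω - W 0 ω)) := fun j => by
    have htel := Finset.sum_range_sub (fun k => W (node t (ns j) k) ω) (ns j + 1)
    simp only [node_last, node_zero] at htel
    rw [Finset.sum_sub_distrib, Finset.sum_sub_distrib, hsq, hsq, Finset.sum_comm, ← htel, mul_sub,
      mul_sub, Finset.mul_sum]
    congr 1
    refine Finset.sum_congr rfl fun k _ => ?_
    have hk := hV (node t (ns j) k)
    rw [← Finset.sum_mul]
    congr 1
    calc _ = ∑ i, X i (node t (ns j) k) ω ^ 2 / V (node t (ns j) k) ω :=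
          Finset.sum_congr rfl fun i _ => by field_simp
      _ = N := by rw [← Finset.sum_div, hsq]; field_simp
  have hlim' := tendsto_nhds_unique (tendsto_const_nhds.congr fun j => (hconst j).symm) hlim
  -- (δ - 3/2)/2 + 1/4 = (δ - 1)/2, and the sum of the squares is `N * V`.
  have hint : ∑ i, ∫ s in Set.Icc (0 : ℝ) t, (2 * (X i s.toNNReal ω
        * ((δ - 3 / 2) * (X i s.toNNReal ω / (4 * V s.toNNReal ω ^ 2))))
        + (X i s.toNNReal ω / (2 * V s.toNNReal ω)) ^ 2)
      = N * ∫ s in Set.Icc (0 : ℝ) t, (δ - 1) / (2 * V s.toNNReal ω) := by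
    rw [← integral_finsetSum, ← integral_const_mul]
    · refine integral_congr_ae (Eventually.of_forall fun s => ?_)
      have hs := hV s.toNNReal
      calc _ = ∑ i, X i s.toNNReal ω ^ 2 * ((δ - 1) / (2 * V s.toNNReal ω ^ 2)) :=
            Finset.sum_congr rfl fun i _ => by field_simp; ring
        _ = _ := by rw [← Finset.sum_mul, hsq]; field_simp
    · intro i _
      have : Continuous fun s : ℝ≥0 => 2 * (X i s ω * ((δ - 3 / 2) * (X i s ω / (4 * V s ω ^ 2))))
          + (X i s ω / (2 * V s ω)) ^ 2 :=
        (continuous_const.mul ((hX i).mul (hu i))).add ((hv i).pow 2)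
      exact (continuous_comp_toNNReal this).integrableOn_Icc
  rw [hint] at hlim'
  have := mul_left_cancel₀ hN hlim'
  linarith

end Ito

/-! ### Moments of empirical measures -/

section Empirical

variable {N d : ℕ} [NeZero N] (x : Fin N → Vec (Fin d))

lemma integral_empirical {E : Type*} [NormedAddCommGroup E] [NormedSpace ℝ E] [CompleteSpace E]
    (f : Vec (Fin d) → E) :
    ∫ y, f y ∂(empirical x : Measure (Vec (Fin d))) = (N : ℝ)⁻¹ • ∑ i, f (x i) := by
  have h : (empirical x : Measure (Vec (Fin d))) = (N : ℝ≥0∞)⁻¹ • ∑ i, Measure.dirac (x i) := rfl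
  rw [h, integral_smul_measure, integral_finsetSum_measure fun i _ => integrable_dirac (by simp)]
  simp

lemma obsMean_empirical (j : Fin d) : obsMean (empirical x) j = (∑ i, x i j) / N := by
  rw [obsMean, integral_empirical]
  simp [div_eq_inv_mul]

lemma integral_marginal_empirical {f : ℝ → ℝ} (hf : Measurable f) (j : Fin d) :
    ∫ y, f y ∂(marginal (empirical x) j) = (∑ i, f (x i j)) / N := by
  have hj : Measurable fun y : Vec (Fin d) => y j := (EuclideanSpace.proj (𝕜 := ℝ) j).measurable
  rw [marginal, integral_map hj.aemeasurable hf.aestronglyMeasurable, integral_empirical,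
    smul_eq_mul, div_eq_inv_mul]

lemma obsSecondMoment_empirical (j : Fin d) :
    obsSecondMoment (empirical x) j = (∑ i, x i j ^ 2) / N :=
  integral_marginal_empirical x (measurable_id.pow_const 2) j

lemma obsVar_empirical (j : Fin d) :
    obsVar (empirical x) j = (∑ i, (x i j - obsMean (empirical x) j) ^ 2) / N := by
  have h1 : ∫ y, id y ∂(marginal (empirical x) j) = obsMean (empirical x) j := by
    rw [integral_marginal_empirical x measurable_id, obsMean_empirical]; rfl
  change Var[id; marginal (empirical x) j] = _
  rw [variance_eq_integral measurable_id.aemeasurable, h1]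
  exact integral_marginal_empirical x ((measurable_id.sub_const _).pow_const 2) j

lemma sum_sub_obsMean_empirical (j : Fin d) :
    ∑ i, (x i j - obsMean (empirical x) j) = 0 := by
  have hN : (N : ℝ) ≠ 0 := Nat.cast_ne_zero.2 (NeZero.ne N)
  rw [Finset.sum_sub_distrib, Finset.sum_const, Finset.card_univ, Fintype.card_fin, nsmul_eq_mul,
    obsMean_empirical]
  field_simp
  ring

end Empirical

/-! ### The mean and the deviations from it -/

section Averages

variable {Ω : Type*} [mΩ : MeasurableSpace Ω] {P : Measure Ω}
  {𝓕 : Filtration ℝ≥0 mΩ} {N : ℕ} [NeZero N] {ι : Type} [Fintype ι]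
  {W : ι → ℝ≥0 → Ω → ℝ}

lemma isItoIntegral_const (W : ℝ≥0 → Ω → ℝ) (c : ℝ) :
    IsItoIntegral P 𝓕 W (fun _ _ => c) fun t ω => c * (W t ω - W 0 ω) := by
  have h := IsItoIntegral.linearCombination (I := Unit) (fun _ => isItoIntegral_one (P := P)
    (𝓕 := 𝓕) (W := W)) (fun _ => Eventually.of_forall fun _ => continuous_const) fun _ => c
  simpa using h

variable [IsProbabilityMeasure P]

/-- The average of Itô processes whose drifts cancel and whose diffusion coefficients average to
the constants `c k`. -/
lemma average_eq (hW : ∀ k, IsScalarBrownianMotion P 𝓕 (W k)) {y u : Fin N → ℝ≥0 → Ω → ℝ}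
    {H M : Fin N → ι → ℝ≥0 → Ω → ℝ} {c : ι → ℝ}
    (hu : ∀ᵐ ω ∂P, ∀ i, Continuous fun t => u i t ω) (hu0 : ∀ t ω, ∑ i, u i t ω = 0)
    (hH : ∀ i k, ∀ᵐ ω ∂P, Continuous fun t => H i k t ω)
    (hHc : ∀ k t ω, ∑ i, H i k t ω = N * c k)
    (hM : ∀ i k, IsItoIntegral P 𝓕 (W k) (H i k) (M i k))
    (heq : ∀ t : ℝ≥0, ∀ᵐ ω ∂P, ∀ i, y i t ω = y i 0 ω
      + (∫ s in Set.Icc (0 : ℝ) t, u i s.toNNReal ω) + ∑ k, M i k t ω) (t : ℝ≥0) :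
    ∀ᵐ ω ∂P, (∑ i, y i t ω) / N = (∑ i, y i 0 ω) / N + ∑ k, c k * (W k t ω - W k 0 ω) := by
  have hN : (N : ℝ) ≠ 0 := Nat.cast_ne_zero.2 (NeZero.ne N)
  -- By linearity the average of the integrals integrates the constant `c k`; uniqueness identifies
  -- it with `c k` times the increment of the noise.
  have hk : ∀ k, ∀ᵐ ω ∂P, ∑ i, (N : ℝ)⁻¹ * M i k t ω = c k * (W k t ω - W k 0 ω) := fun k => by
    have h := IsItoIntegral.linearCombination (fun i => hM i k) (fun i => hH i k)
      fun _ => (N : ℝ)⁻¹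
    have h0 : (fun (t : ℝ≥0) (ω : Ω) => ∑ i, (N : ℝ)⁻¹ * H i k t ω) = fun _ _ => c k := by
      ext t ω
      rw [← Finset.mul_sum, hHc]
      field_simp
    rw [h0] at h
    exact h.ae_eq (hW k) (isItoIntegral_const (W k) (c k))
      (Eventually.of_forall fun _ => continuous_const) t
  filter_upwards [hu, heq t, ae_all_iff.2 hk] with ω hu heq hk
  have hint : ∑ i, ∫ s in Set.Icc (0 : ℝ) t, u i s.toNNReal ω = 0 := by
    rw [← integral_finsetSum _ fun i _ => (continuous_comp_toNNReal (hu i)).integrableOn_Icc]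
    simp [hu0]
  have hsum : ∑ i, y i t ω = ∑ i, y i 0 ω + ∑ i, ∑ k, M i k t ω := by
    rw [Finset.sum_congr rfl fun i _ => heq i, Finset.sum_add_distrib, Finset.sum_add_distrib, hint,
      add_zero]
  rw [hsum, add_div, Finset.sum_comm]
  refine congrArg _ ((Finset.sum_div _ _ _).trans (Finset.sum_congr rfl fun k _ => ?_))
  rw [← hk k, Finset.sum_div]
  exact Finset.sum_congr rfl fun i _ => div_eq_inv_mul _ _

variable [DecidableEq ι]

/-- If the deviations of `y_i` from the mean satisfy the linear system of `bessel_of_mean_sq`, up to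
common noises, then the variance `V` is a `δ`-Bessel process. -/
lemma bessel_of_variance (hW : ∀ k, IsScalarBrownianMotion P 𝓕 (W k)) (δ : ℝ)
    {y : Fin N → ℝ≥0 → Ω → ℝ} {m V : ℝ≥0 → Ω → ℝ} (hm : ∀ t ω, m t ω = (∑ i, y i t ω) / N)
    (hV : ∀ t ω, V t ω = (∑ i, (y i t ω - m t ω) ^ 2) / N)
    (hym : ∀ i t, Measurable[𝓕 t] (y i t)) (hy : ∀ᵐ ω ∂P, ∀ i, Continuous fun t => y i t ω)
    (hVpos : ∀ᵐ ω ∂P, ∀ t, 0 < V t ω) (k₀ : ι) {M : Fin N → ι → ℝ≥0 → Ω → ℝ}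
    {H : Fin N → ι → ℝ≥0 → Ω → ℝ} {c : ι → ℝ}
    (hH : ∀ i k, H i k = if k = k₀ then fun t ω => (y i t ω - m t ω) / (2 * V t ω)
      else fun _ _ => c k)
    (hM : ∀ i k, IsItoIntegral P 𝓕 (W k) (H i k) (M i k))
    (heq : ∀ t : ℝ≥0, ∀ᵐ ω ∂P, ∀ i, y i t ω = y i 0 ω + (∫ s in Set.Icc (0 : ℝ) t,
      (δ - 3 / 2) * ((y i s.toNNReal ω - m s.toNNReal ω) / (4 * V s.toNNReal ω ^ 2)))
        + ∑ k, M i k t ω) (t : ℝ≥0) :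
    ∀ᵐ ω ∂P, V t ω = V 0 ω + (∫ s in Set.Icc (0 : ℝ) t, (δ - 1) / (2 * V s.toNNReal ω))
      + (W k₀ t ω - W k₀ 0 ω) := by
  have hN : (N : ℝ) ≠ 0 := Nat.cast_ne_zero.2 (NeZero.ne N)
  have hmm : ∀ t, Measurable[𝓕 t] (m t) := fun t => by
    rw [show m t = fun ω => (∑ i, y i t ω) / N from funext (hm t)]
    exact (Finset.measurable_fun_sum _ fun i _ => hym i t).div_const _
  have hmc : ∀ᵐ ω ∂P, Continuous fun t => m t ω := by
    filter_upwards [hy] with ω hω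
    simp_rw [hm]
    exact (continuous_finsetSum _ fun i _ => hω i).div_const _
  have hVc : ∀ᵐ ω ∂P, Continuous fun t => V t ω := by
    filter_upwards [hy, hmc] with ω h1 h2
    simp_rw [hV]
    exact (continuous_finsetSum _ fun i _ => ((h1 i).sub h2).pow 2).div_const _
  have hu : ∀ᵐ ω ∂P, ∀ i,
      Continuous fun t => (δ - 3 / 2) * ((y i t ω - m t ω) / (4 * V t ω ^ 2)) := by
    filter_upwards [hy, hmc, hVc, hVpos] with ω h1 h2 h3 h4 i
    exact continuous_const.mul (((h1 i).sub h2).div₀ (continuous_const.mul (h3.pow 2)) fun t =>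
      (mul_pos four_pos (pow_pos (h4 t) 2)).ne')
  have hHc : ∀ i k, ∀ᵐ ω ∂P, Continuous fun t => H i k t ω := fun i k => by
    rw [hH]
    split_ifs
    · filter_upwards [hy, hmc, hVc, hVpos] with ω h1 h2 h3 h4
      exact ((h1 i).sub h2).div₀ (continuous_const.mul h3) fun t => (mul_pos two_pos (h4 t)).ne'
    · exact Eventually.of_forall fun _ => continuous_const
  have hdev : ∀ t ω, ∑ i, (y i t ω - m t ω) = 0 := fun t ω => by
    rw [Finset.sum_sub_distrib, Finset.sum_const, Finset.card_univ, Fintype.card_fin, nsmul_eq_mul,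
      hm]
    field_simp
    ring
  -- The stochastic integral of particle `i` minus the average over particles: the martingale part
  -- of the deviation.
  let M' : Fin N → ι → ℝ≥0 → Ω → ℝ := fun i k t ω => M i k t ω - ∑ l, (N : ℝ)⁻¹ * M l k t ω
  have hM' : ∀ i k, IsItoIntegral P 𝓕 (W k)
      (fun t ω => H i k t ω - ∑ l, (N : ℝ)⁻¹ * H l k t ω) (M' i k) := fun i k => by
    have h := IsItoIntegral.linearCombination (fun i => hM i k) (fun i => hHc i k)
      fun l => (if l = i then 1 else 0) - (N : ℝ)⁻¹
    simpa [sub_mul, Finset.sum_sub_distrib] using h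
  -- Deviations sum to zero, so subtracting the average leaves the `k₀` integrand unchanged.
  have hM₀ : ∀ i, IsItoIntegral P 𝓕 (W k₀) (fun t ω => (y i t ω - m t ω) / (2 * V t ω))
      (M' i k₀) := fun i => by
    have h := hM' i k₀
    simp only [hH, if_true] at h
    have h0 : (fun (t : ℝ≥0) (ω : Ω) => (y i t ω - m t ω) / (2 * V t ω)
        - ∑ l, (N : ℝ)⁻¹ * ((y l t ω - m t ω) / (2 * V t ω)))
        = fun t ω => (y i t ω - m t ω) / (2 * V t ω) := by
      ext t ω
      rw [← Finset.mul_sum, ← Finset.sum_div, hdev]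
      simp
    rwa [h0] at h
  -- For every other noise the integrand is the same constant for all particles and cancels against
  -- its average.
  have hMk : ∀ i k, k ≠ k₀ → ∀ t, ∀ᵐ ω ∂P, M' i k t ω = 0 := fun i k hk t => by
    have h := hM' i k
    simp only [hH, if_neg hk] at h
    have h0 : (fun (_ : ℝ≥0) (_ : Ω) => c k - ∑ _l : Fin N, (N : ℝ)⁻¹ * c k) = fun _ _ => 0 := by
      ext t ω
      rw [Finset.sum_const, Finset.card_univ, Fintype.card_fin, nsmul_eq_mul]
      field_simp
      ring
    rw [h0] at h
    exact h.ae_eq_zero (hW k) t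
  refine bessel_of_mean_sq (hW k₀) δ (X := fun i t ω => y i t ω - m t ω) (M := fun i => M' i k₀) hV
    (fun i t => (hym i t).sub (hmm t)) ?_ hVpos hM₀ (fun t => ?_) t
  · filter_upwards [hy, hmc] with ω h1 h2 i
    exact (h1 i).sub h2
  · have hMk' : ∀ᵐ ω ∂P, ∀ i k, k ≠ k₀ → M' i k t ω = 0 := by
      refine ae_all_iff.2 fun i => ae_all_iff.2 fun k => ?_
      by_cases hk : k = k₀
      · exact Eventually.of_forall fun ω h => absurd hk h
      · filter_upwards [hMk i k hk t] with ω hω _ using hω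
    filter_upwards [heq t, hMk', hu] with ω heq hMk hu i
    have hint : ∑ i, ∫ s in Set.Icc (0 : ℝ) t,
        (δ - 3 / 2) * ((y i s.toNNReal ω - m s.toNNReal ω) / (4 * V s.toNNReal ω ^ 2)) = 0 := by
      rw [← integral_finsetSum _ fun i _ => (continuous_comp_toNNReal (hu i)).integrableOn_Icc]
      simp_rw [← Finset.mul_sum, ← Finset.sum_div, hdev]
      simp
    have hmt : m t ω = m 0 ω + ∑ k, ∑ l, (N : ℝ)⁻¹ * M l k t ω := by
      rw [hm, hm, Finset.sum_congr rfl fun i _ => heq i, Finset.sum_add_distrib,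
        Finset.sum_add_distrib, hint, add_zero, add_div, Finset.sum_comm]
      simp_rw [← Finset.mul_sum]
      rw [div_eq_inv_mul (∑ k, ∑ l, M l k t ω)]
    have hsum : ∑ k, M i k t ω - ∑ k, ∑ l, (N : ℝ)⁻¹ * M l k t ω = M' i k₀ t ω := by
      rw [← Finset.sum_sub_distrib]
      exact Finset.sum_eq_single k₀ (fun k _ hk => hMk i k hk) fun h =>
        absurd (Finset.mem_univ _) h
    rw [heq i, hmt, ← hsum]
    ring

end Averages

/-! ### The four observables -/

section Systems

lemma measurable_coordinate {κ : Type} [Fintype κ] {Ω : Type*} {m : MeasurableSpace Ω} {f : Ω → Vec κ}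
    (hf : Measurable[m] f) (j : κ) : Measurable[m] fun ω => f ω j :=
  (EuclideanSpace.proj (𝕜 := ℝ) j).measurable.comp hf

lemma continuous_coordinate {κ : Type} [Fintype κ] {f : ℝ≥0 → Vec κ} (hf : Continuous f) (j : κ) :
    Continuous fun t => f t j := (EuclideanSpace.proj (𝕜 := ℝ) j).continuous.comp hf

variable {Ω : Type*} [mΩ : MeasurableSpace Ω] {P : Measure Ω} {𝓕 : Filtration ℝ≥0 mΩ}

/-- A coordinatewise criterion for SDEs with identity diffusion matrix. -/
lemma solvesSDE_of_coordinates {κ : Type} [Fintype κ] [DecidableEq κ]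
    {B : ℝ≥0 → Ω → Vec κ} {a : Vec κ → Vec κ} {σ : Vec κ → Matrix κ κ ℝ} (hσ : ∀ z, σ z = 1)
    {Z : ℝ≥0 → Ω → Vec κ} (hZm : ∀ j t, Measurable[𝓕 t] fun ω => Z t ω j)
    (hZ : ∀ᵐ ω ∂P, ∀ j, Continuous fun t => Z t ω j)
    (ha : ∀ᵐ ω ∂P, ∀ j, Continuous fun t => a (Z t ω) j)
    (heq : ∀ j, ∀ t : ℝ≥0, ∀ᵐ ω ∂P, Z t ω j = Z 0 ω j
      + (∫ s in Set.Icc (0 : ℝ) t, a (Z s.toNNReal ω) j) + (B t ω j - B 0 ω j)) :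
    SolvesSDE P 𝓕 B a σ Z where
  adapted t := (WithLp.measurable_toLp 2 (κ → ℝ)).comp
    (@measurable_pi_lambda _ _ _ (𝓕 t) _ (fun ω => WithLp.ofLp (Z t ω)) fun j => hZm j t)
  cont := by
    filter_upwards [hZ] with ω hω
    exact (PiLp.continuous_toLp 2 _).comp (continuous_pi hω)
  drift_integrable := by
    filter_upwards [ha] with ω hω t
    have h : Continuous fun t => a (Z t ω) := (PiLp.continuous_toLp 2 _).comp (continuous_pi hω)
    exact (h.comp continuous_real_toNNReal).integrableOn_Icc
  eq := by
    -- With identity diffusion the integrals are explicit: the increment of `B` on the diagonal,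
    -- zero elsewhere.
    refine ⟨fun j k t ω => if j = k then B t ω k - B 0 ω k else 0, fun j k => ?_, fun t => ?_⟩
    · simp only [hσ, Matrix.one_apply]
      split_ifs
      · exact isItoIntegral_one
      · exact isItoIntegral_zero
    · filter_upwards [ae_all_iff.2 fun j => heq j t] with ω hω j
      rw [hω j]
      simp

variable {N d : ℕ} [NeZero N] {Y : Fin N → ℝ≥0 → Ω → Vec (Fin d)} {ι : Type} [Fintype ι]
  {B : ℝ≥0 → Ω → Vec ι}
  {b : Vec (Fin d) → ProbabilityMeasure (Vec (Fin d)) → Vec (Fin d)}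
  {σ : Vec (Fin d) → ProbabilityMeasure (Vec (Fin d)) → Matrix (Fin d) ι ℝ}

namespace SolvesParticleSystem

lemma measurable (h : SolvesParticleSystem P 𝓕 B b σ Y) (j : Fin d) (i : Fin N) (t : ℝ≥0) :
    Measurable[𝓕 t] fun ω => Y i t ω j := measurable_coordinate ((h i).adapted t) j

lemma continuous (h : SolvesParticleSystem P 𝓕 B b σ Y) :
    ∀ᵐ ω ∂P, ∀ j i, Continuous fun t => Y i t ω j := by
  filter_upwards [ae_all_iff.2 fun i => (h i).cont] with ω hω j i
  exact continuous_coordinate (hω i) j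

lemma exists_integrals (h : SolvesParticleSystem P 𝓕 B b σ Y) (j : Fin d) :
    ∃ M : Fin N → ι → ℝ≥0 → Ω → ℝ,
      (∀ i k, IsItoIntegral P 𝓕 (fun t ω => B t ω k)
        (fun t ω => σ (Y i t ω) (empirical fun l => Y l t ω) j k) (M i k)) ∧
      ∀ t : ℝ≥0, ∀ᵐ ω ∂P, ∀ i, Y i t ω j = Y i 0 ω j + (∫ s in Set.Icc (0 : ℝ) t,
        b (Y i s.toNNReal ω) (empirical fun l => Y l s.toNNReal ω) j) + ∑ k, M i k t ω := by
  choose M hM heq using fun i => (h i).eq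
  refine ⟨fun i => M i j, fun i => hM i j, fun t => ?_⟩
  filter_upwards [ae_all_iff.2 fun i => heq i t] with ω hω i
  exact hω i j

lemma mean_measurable (h : SolvesParticleSystem P 𝓕 B b σ Y) (j : Fin d) (t : ℝ≥0) :
    Measurable[𝓕 t] fun ω => obsMean (empirical fun l => Y l t ω) j := by
  simp only [obsMean_empirical]
  exact (Finset.measurable_fun_sum _ fun i _ => h.measurable j i t).div_const _

lemma mean_continuous (h : SolvesParticleSystem P 𝓕 B b σ Y) :
    ∀ᵐ ω ∂P, ∀ j, Continuous fun t => obsMean (empirical fun l => Y l t ω) j := by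
  filter_upwards [h.continuous] with ω hω j
  simp only [obsMean_empirical]
  exact (continuous_finsetSum _ fun i _ => hω j i).div_const _

lemma secondMoment_measurable (h : SolvesParticleSystem P 𝓕 B b σ Y) (j : Fin d) (t : ℝ≥0) :
    Measurable[𝓕 t] fun ω => obsSecondMoment (empirical fun l => Y l t ω) j := by
  simp only [obsSecondMoment_empirical]
  exact (Finset.measurable_fun_sum _ fun i _ => (h.measurable j i t).pow_const 2).div_const _

lemma secondMoment_continuous (h : SolvesParticleSystem P 𝓕 B b σ Y) :
    ∀ᵐ ω ∂P, ∀ j, Continuous fun t => obsSecondMoment (empirical fun l => Y l t ω) j := by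
  filter_upwards [h.continuous] with ω hω j
  simp only [obsSecondMoment_empirical]
  exact (continuous_finsetSum _ fun i _ => (hω j i).pow 2).div_const _

lemma var_measurable (h : SolvesParticleSystem P 𝓕 B b σ Y) (j : Fin d) (t : ℝ≥0) :
    Measurable[𝓕 t] fun ω => obsVar (empirical fun l => Y l t ω) j := by
  simp only [obsVar_empirical]
  exact (Finset.measurable_fun_sum _ fun i _ =>
    ((h.measurable j i t).sub (h.mean_measurable j t)).pow_const 2).div_const _

lemma var_continuous (h : SolvesParticleSystem P 𝓕 B b σ Y) :
    ∀ᵐ ω ∂P, ∀ j, Continuous fun t => obsVar (empirical fun l => Y l t ω) j := by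
  filter_upwards [h.continuous, h.mean_continuous] with ω h1 h2 j
  simp only [obsVar_empirical]
  exact (continuous_finsetSum _ fun i _ => ((h1 j i).sub (h2 j)).pow 2).div_const _

end SolvesParticleSystem

lemma continuous_besselDrift (δ : ℝ) {f : ℝ≥0 → ℝ} (hf : Continuous f) (hpos : ∀ t, 0 < f t) :
    Continuous fun t => (δ - 1) / (2 * f t) :=
  continuous_const.div₀ (continuous_const.mul hf) fun t => (mul_pos two_pos (hpos t)).ne'

lemma continuous_driftVar (δ : ℝ) {x m V : ℝ≥0 → ℝ} (hx : Continuous x) (hm : Continuous m)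
    (hV : Continuous V) (hpos : ∀ t, 0 < V t) :
    Continuous fun t => (δ - 3 / 2) * ((x t - m t) / (4 * V t ^ 2)) :=
  continuous_const.mul ((hx.sub hm).div₀ (continuous_const.mul (hV.pow 2)) fun t =>
    (mul_pos four_pos (pow_pos (hpos t) 2)).ne')

variable [IsProbabilityMeasure P]

theorem mean_solvesSDE {B : ℝ≥0 → Ω → Vec (Fin d)} (hB : IsBrownianMotion P 𝓕 B)
    (h : SolvesParticleSystem P 𝓕 B driftMean diffusionMean Y) :
    SolvesSDE P 𝓕 B (fun _ => 0) (fun _ => 1)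
      (fun t ω => obsMean (empirical fun l => Y l t ω)) := by
  refine solvesSDE_of_coordinates (fun _ => rfl) h.mean_measurable h.mean_continuous
    (Eventually.of_forall fun ω j => continuous_const) fun j t => ?_
  obtain ⟨M, hM, heq⟩ := h.exists_integrals j
  filter_upwards [average_eq (fun k => hB.coordinate k) (y := fun i t ω => Y i t ω j)
    (u := fun _ _ _ => 0) (H := fun i k _ _ => (1 : Matrix (Fin d) (Fin d) ℝ) j k)
    (c := fun k => (1 : Matrix (Fin d) (Fin d) ℝ) j k)
    (Eventually.of_forall fun ω i => continuous_const) (fun _ _ => by simp)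
    (fun i k => Eventually.of_forall fun ω => continuous_const) (fun _ _ _ => by simp) hM heq t]
    with ω hω
  simp only [obsMean_empirical]
  rw [hω]
  simp [Matrix.one_apply]

theorem secondMoment_solvesSDE {B : ℝ≥0 → Ω → Vec (Fin d)} (hB : IsBrownianMotion P 𝓕 B) (δ : ℝ)
    (hpos : ∀ᵐ ω ∂P, ∀ t j, 0 < obsSecondMoment (empirical fun l => Y l t ω) j)
    (h : SolvesParticleSystem P 𝓕 B (driftSecondMoment δ) diffusionSecondMoment Y) :
    SolvesSDE P 𝓕 B (besselDrift δ) besselDiffusion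
      (fun t ω => obsSecondMoment (empirical fun l => Y l t ω)) := by
  refine solvesSDE_of_coordinates (fun _ => rfl) h.secondMoment_measurable
    h.secondMoment_continuous ?_ fun j t => ?_
  · filter_upwards [h.secondMoment_continuous, hpos] with ω h1 h2 j
    exact continuous_besselDrift δ (h1 j) fun t => h2 t j
  obtain ⟨M, hM, heq⟩ := h.exists_integrals j
  refine bessel_of_mean_sq (hB.coordinate j) δ (X := fun i t ω => Y i t ω j) (M := fun i => M i j)
    (V := fun t ω => obsSecondMoment (empirical fun l => Y l t ω) j)
    (fun t ω => obsSecondMoment_empirical _ j) (h.measurable j)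
    (h.continuous.mono fun ω hω => hω j) (hpos.mono fun ω hω t => hω t j) (fun i => ?_)
    (fun t => ?_) t
  · simpa [diffusionSecondMoment] using hM i j
  -- The diffusion matrix is diagonal, so only the `j`-th noise reaches coordinate `j`; the other
  -- integrals vanish by uniqueness.
  · have hzero : ∀ᵐ ω ∂P, ∀ i k, k ≠ j → M i k t ω = 0 := by
      refine ae_all_iff.2 fun i => ae_all_iff.2 fun k => ?_
      by_cases hk : k = j
      · exact Eventually.of_forall fun ω h => absurd hk h
      · have h1 := hM i k
        simp only [diffusionSecondMoment, Matrix.diagonal_apply_ne' _ hk] at h1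
        filter_upwards [h1.ae_eq_zero (hB.coordinate k) t] with ω hω _ using hω
    filter_upwards [heq t, hzero] with ω h1 h2 i
    rw [h1 i, Finset.sum_eq_single j (fun k _ hk => h2 i k hk) fun h =>
      absurd (Finset.mem_univ _) h]
    rfl

theorem var_solvesSDE {B : ℝ≥0 → Ω → Vec (Fin d)} (hB : IsBrownianMotion P 𝓕 B) (δ : ℝ)
    (hpos : ∀ᵐ ω ∂P, ∀ t j, 0 < obsVar (empirical fun l => Y l t ω) j)
    (h : SolvesParticleSystem P 𝓕 B (driftVar δ) diffusionVar Y) :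
    SolvesSDE P 𝓕 B (besselDrift δ) besselDiffusion
      (fun t ω => obsVar (empirical fun l => Y l t ω)) := by
  refine solvesSDE_of_coordinates (fun _ => rfl) h.var_measurable h.var_continuous ?_ fun j t => ?_
  · filter_upwards [h.var_continuous, hpos] with ω h1 h2 j
    exact continuous_besselDrift δ (h1 j) fun t => h2 t j
  obtain ⟨M, hM, heq⟩ := h.exists_integrals j
  refine bessel_of_variance (fun k => hB.coordinate k) δ (y := fun i t ω => Y i t ω j)
    (m := fun t ω => obsMean (empirical fun l => Y l t ω) j)
    (V := fun t ω => obsVar (empirical fun l => Y l t ω) j)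
    (fun t ω => obsMean_empirical _ j) (fun t ω => obsVar_empirical _ j) (h.measurable j)
    (h.continuous.mono fun ω hω => hω j) (hpos.mono fun ω hω t => hω t j) j (c := fun _ => 0)
    (fun i k => ?_) hM heq t
  split_ifs with hk
  · subst hk; simp [diffusionVar]
  · simp [diffusionVar, Matrix.diagonal_apply_ne' _ hk]

lemma meanVarTargetDiffusion_eq_one (z : Vec (Fin d ⊕ Fin d)) : meanVarTargetDiffusion z = 1 :=
  Matrix.fromBlocks_one

theorem meanVar_solvesSDE {B : ℝ≥0 → Ω → Vec (Fin d ⊕ Fin d)} (hB : IsBrownianMotion P 𝓕 B) (δ : ℝ)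
    (hpos : ∀ᵐ ω ∂P, ∀ t j, 0 < obsVar (empirical fun l => Y l t ω) j)
    (h : SolvesParticleSystem P 𝓕 B (driftVar δ) diffusionMeanVar Y) :
    SolvesSDE P 𝓕 B (meanVarTargetDrift δ) meanVarTargetDiffusion
      (fun t ω => obsMeanVar (empirical fun l => Y l t ω)) := by
  refine solvesSDE_of_coordinates meanVarTargetDiffusion_eq_one ?_ ?_ ?_ ?_
  · rintro (j | j) t
    · exact h.mean_measurable j t
    · exact h.var_measurable j t
  · filter_upwards [h.mean_continuous, h.var_continuous] with ω h1 h2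
    rintro (j | j)
    · exact h1 j
    · exact h2 j
  · filter_upwards [h.var_continuous, hpos] with ω h1 h2
    rintro (j | j)
    · exact continuous_const
    · exact continuous_besselDrift δ (h1 j) fun t => h2 t j
  rintro (j | j) t
  · obtain ⟨M, hM, heq⟩ := h.exists_integrals j
    -- The constants form row `Sum.inl j` of the identity: the first block is already constant in
    -- the particle, and the second averages to zero because deviations do.
    filter_upwards [average_eq (fun k => hB.coordinate k) (y := fun i t ω => Y i t ω j)
      (c := fun k => (1 : Matrix (Fin d ⊕ Fin d) (Fin d ⊕ Fin d) ℝ) (Sum.inl j) k)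
      (u := fun i t ω => driftVar δ (Y i t ω) (empirical fun l => Y l t ω) j)
      (by
        filter_upwards [h.continuous, h.mean_continuous, h.var_continuous, hpos]
          with ω h1 h2 h3 h4 i
        exact continuous_driftVar δ (h1 j i) (h2 j) (h3 j) fun t => h4 t j)
      (fun t ω => by
        simp only [driftVar]
        rw [← Finset.mul_sum, ← Finset.sum_div, sum_sub_obsMean_empirical, zero_div, mul_zero])
      (fun i k => by
        filter_upwards [h.continuous, h.mean_continuous, h.var_continuous, hpos] with ω h1 h2 h3 h4
        rcases k with k | k
        · exact continuous_const
        · by_cases hk : j = k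
          · subst hk
            simp only [diffusionMeanVar, Matrix.fromCols_apply_inr, diffusionVar,
              Matrix.diagonal_apply_eq]
            exact ((h1 j i).sub (h2 j)).div₀ (continuous_const.mul (h3 j)) fun t =>
              (mul_pos two_pos (h4 t j)).ne'
          · simp only [diffusionMeanVar, Matrix.fromCols_apply_inr, diffusionVar,
              Matrix.diagonal_apply_ne _ hk]
            exact continuous_const)
      (fun k t ω => by
        rcases k with k | k
        · simp [diffusionMeanVar, Matrix.one_apply]
        · by_cases hk : j = k
          · subst hk
            simp only [diffusionMeanVar, Matrix.fromCols_apply_inr, diffusionVar,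
              Matrix.diagonal_apply_eq]
            rw [← Finset.sum_div, sum_sub_obsMean_empirical]
            simp
          · simp [diffusionMeanVar, diffusionVar, hk]) hM heq t] with ω hω
    have hmean : ∀ t, obsMeanVar (empirical fun l => Y l t ω) (Sum.inl j)
        = (∑ i, Y i t ω j) / N := fun t => obsMean_empirical _ j
    rw [hmean, hmean, hω]
    simp [Matrix.one_apply, meanVarTargetDrift]
  · obtain ⟨M, hM, heq⟩ := h.exists_integrals j
    -- The driving noise is `Sum.inr j`; the noise `Sum.inl j` translates all particles together, so
    -- it falls among the common noises that cancel in the deviations.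
    refine bessel_of_variance (fun k => hB.coordinate k) δ (y := fun i t ω => Y i t ω j)
      (m := fun t ω => obsMean (empirical fun l => Y l t ω) j)
      (V := fun t ω => obsVar (empirical fun l => Y l t ω) j)
      (fun t ω => obsMean_empirical _ j) (fun t ω => obsVar_empirical _ j) (h.measurable j)
      (h.continuous.mono fun ω hω => hω j) (hpos.mono fun ω hω t => hω t j) (Sum.inr j)
      (c := fun k => (1 : Matrix (Fin d ⊕ Fin d) (Fin d ⊕ Fin d) ℝ) (Sum.inl j) k)
      (fun i k => ?_) hM heq t
    rcases k with k | k
    · simp [diffusionMeanVar, Matrix.one_apply]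
    · by_cases hk : k = j
      · subst hk; simp [diffusionMeanVar, diffusionVar]
      · simp [diffusionMeanVar, diffusionVar, hk, Matrix.diagonal_apply_ne' _ hk]

end Systems

end SMD

end

theorem mainTheorem2 {Ω : Type*} [mΩ : MeasurableSpace Ω] (P : Measure Ω)
    [IsProbabilityMeasure P] (𝓕 : Filtration ℝ≥0 mΩ) (d N : ℕ) [NeZero N]
    (δ : ℝ) (hδ : 2 ≤ δ) (Y : Fin N → ℝ≥0 → Ω → SMD.Vec (Fin d)) :
    -- mean
    (∀ B : ℝ≥0 → Ω → SMD.Vec (Fin d), SMD.IsBrownianMotion P 𝓕 B →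
      SMD.SolvesParticleSystem P 𝓕 B SMD.driftMean SMD.diffusionMean Y →
      SMD.SolvesSDE P 𝓕 B (fun _ => 0) (fun _ => 1)
        (fun t ω => SMD.obsMean (SMD.empirical fun l => Y l t ω))) ∧
    -- second moment
    (∀ B : ℝ≥0 → Ω → SMD.Vec (Fin d), SMD.IsBrownianMotion P 𝓕 B →
      (∀ᵐ ω ∂P, ∀ t j, 0 < SMD.obsSecondMoment (SMD.empirical fun l => Y l t ω) j) →
      SMD.SolvesParticleSystem P 𝓕 B (SMD.driftSecondMoment δ) SMD.diffusionSecondMoment Y →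
      SMD.SolvesSDE P 𝓕 B (SMD.besselDrift δ) SMD.besselDiffusion
        (fun t ω => SMD.obsSecondMoment (SMD.empirical fun l => Y l t ω))) ∧
    -- variance
    (∀ B : ℝ≥0 → Ω → SMD.Vec (Fin d), SMD.IsBrownianMotion P 𝓕 B →
      (∀ᵐ ω ∂P, ∀ t j, 0 < SMD.obsVar (SMD.empirical fun l => Y l t ω) j) →
      SMD.SolvesParticleSystem P 𝓕 B (SMD.driftVar δ) SMD.diffusionVar Y →
      SMD.SolvesSDE P 𝓕 B (SMD.besselDrift δ) SMD.besselDiffusion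
        (fun t ω => SMD.obsVar (SMD.empirical fun l => Y l t ω))) ∧
    -- mean and variance
    (∀ B : ℝ≥0 → Ω → SMD.Vec (Fin d ⊕ Fin d), SMD.IsBrownianMotion P 𝓕 B →
      (∀ᵐ ω ∂P, ∀ t j, 0 < SMD.obsVar (SMD.empirical fun l => Y l t ω) j) →
      SMD.SolvesParticleSystem P 𝓕 B (SMD.driftVar δ) SMD.diffusionMeanVar Y →
      SMD.SolvesSDE P 𝓕 B (SMD.meanVarTargetDrift δ) SMD.meanVarTargetDiffusion
        (fun t ω => SMD.obsMeanVar (SMD.empirical fun l => Y l t ω))) := by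
  exact ⟨fun B hB h => SMD.mean_solvesSDE hB h,
    fun B hB hpos h => SMD.secondMoment_solvesSDE hB δ hpos h,
    fun B hB hpos h => SMD.var_solvesSDE hB δ hpos h,
    fun B hB hpos h => SMD.meanVar_solvesSDE hB δ hpos h⟩
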